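/- **Conventions.** The *fat delta* $\underline\Delta$ has as objects the finite non-empty coloured ordinals $\underline k$: vertices $0<1<\dots<s$ together with a set of coloured edges ("links") among the $s$ edges $\{j,j+1\}$. An arrow $x\le y$ between vertices is coloured if all edges between $x$ and $y$ are links. Morphisms of $\underline\Delta$ are the strictly monotone maps on vertices that send coloured arrows to coloured arrows. Contracting all links gives $\pi(\underline k)$; a morphism $f$ is *vertical* (coloured) if $\pi(f)$ is an isomorphism of ordinals. Write $[0]$ for the object with one vertex, $[1]$ for the object with one uncoloured edge, $U$ for the object with one edge, which is a link, and, for $Y:\underline\Delta^{op}\to\mathrm{Cat}$, $Y_0,Y_1,Y_U$ for its values at them. For each edge $j$ of $\underline k$ let $\tilde 1_j\in\{[1],U\}$ be that edge with its colour, included in $\underline k$. The source and target maps $Y_{\tilde 1_j}\rightrightarrows Y_0$ are induced by the two vertices of $\tilde 1_j$. $\mathrm{Ps}[\underline\Delta^{op},\mathrm{Cat}]$ is the category of pseudo-functors $\underline\Delta^{op}\to\mathrm{Cat}$ and pseudo-natural transformations, and $[\underline\Delta^{op},\mathrm{Cat}]$ that of functors and natural transformations. The strictification $\mathrm{St}\,H=L$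 of a pseudo-functor $H$ is obtained by factorizing, for each $\underline k$, the functor $$h_{\underline k}:\coprod_{\underline r}\coprod_{f\in\underline\Delta(\underline k,\underline r)}H_{\underline r}\to H_{\underline k},$$ equal to $H(f)$ on the summand $f$, as a bijective on objects functor followed by a fully faithful functor $L_{\underline k}\to H_{\underline k}$. A morphism $w:\underline m\to\underline k$ acts on $L$ by $(\underline r,f,y)\mapsto(\underline r,fw,y)$ on objects, and on morphisms by $H(w)$ conjugated by the coherence isomorphisms of $H$. A *Segalic pseudo-functor* is a pseudo-functor $H:\underline\Delta^{op}\to\mathrm{Cat}$ such that * (i) $H_0$ is discrete; * (ii) for every $\underline k$ with $s\ge 2$ edges, the Segal map $H_{\underline k}\to H_{\tilde 1_1}\times_{H_0}\cdots\times_{H_0}H_{\tilde 1_s}$ is an isomorphism of categories; * (iii) the two maps $H_U\rightrightarrows H_0$ and the three composition maps $H_U\times_{H_0}H_1\to H_1$, $H_1\times_{H_0}H_U\to H_1$, $H_U\times_{H_0}H_U\to H_U$ (under (ii), the images under $H$ of the morphisms preserving first and last vertex from a one-edge object to the two-edge objects with colours link–plain, plain–link and link–link, where the one-edge object is a link only in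 the last case) are equivalences of categories. They span the full subcategory $\mathrm{SegPs}[\underline\Delta^{op},\mathrm{Cat}]$ of $\mathrm{Ps}[\underline\Delta^{op},\mathrm{Cat}]$. A *weakly globular fair $2$-category* is a functor $X:\underline\Delta^{op}\to\mathrm{Cat}$ such that * (a) $X_0$ is homotopically discrete (a groupoid with no non-trivial loops); * (b) for every $\underline k$ with $s\ge 2$ edges, the Segal map $X_{\underline k}\to X_{\tilde 1_1}\times_{X_0}\cdots\times_{X_0}X_{\tilde 1_s}$ is an isomorphism of categories; * (c) for every such $\underline k$, the induced Segal map $X_{\tilde 1_1}\times_{X_0}\cdots\times_{X_0}X_{\tilde 1_s}\to X_{\tilde 1_1}\times_{X_0^d}\cdots\times_{X_0^d}X_{\tilde 1_s}$ is an equivalence of categories, where $X_0\to X_0^d$ is the projection to the discrete category on the set of isomorphism classes of objects of $X_0$; * (d) $X$ sends vertical morphisms to equivalences of categories. They span the full subcategory $\mathrm{Fair}^2_{wg}$ of $[\underline\Delta^{op},\mathrm{Cat}]$. **Theorem.** The strictification functor $\mathrm{St}:\mathrm{Ps}[\underline\Delta^{op},\mathrm{Cat}]\to[\underline\Delta^{op},\mathrm{Cat}]$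 restricts to a functor $$\mathrm{St}:\mathrm{SegPs}[\underline\Delta^{op},\mathrm{Cat}]\to\mathrm{Fair}^2_{wg}.$$ Further, for each $H\in\mathrm{SegPs}[\underline\Delta^{op},\mathrm{Cat}]$ there is a pseudo-natural transformation $\mathrm{St}\,H\to H$ all of whose components are equivalences of categories. -/

import Mathlib

open CategoryTheory Opposite Bicategory

universe v u

/-! ## Pseudofunctors and their strictification -/

section Strictification

variable (C : Type) [SmallCategory C]

/-- Pseudofunctors `Cᵒᵖ → Cat`. -/
abbrev Ps := LocallyDiscrete Cᵒᵖ ⥤ᵖ Cat.{v, u}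

variable {C} in
lemma Ps.strongTrans_ext {H K : Ps.{v, u} C} {α β : Pseudofunctor.StrongTrans H K}
    (h : α.app = β.app) (h' : @α.naturality ≍ @β.naturality) : α = β := by
  obtain ⟨app, nat, _, _, _⟩ := α
  obtain ⟨app', nat', _, _, _⟩ := β
  obtain rfl : app = app' := h
  obtain rfl : @nat = @nat' := eq_of_heq h'
  rfl

variable {C} in
lemma Ps.vcomp_naturality_app {H K L : Ps.{v, u} C} (α : Pseudofunctor.StrongTrans H K)
    (β : Pseudofunctor.StrongTrans K L) {a b : LocallyDiscrete Cᵒᵖ} (f : a ⟶ b) (y : H.obj a) :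
    ((α.vcomp β).naturality f).hom.toNatTrans.app y =
      (β.app b).toFunctor.map ((α.naturality f).hom.toNatTrans.app y) ≫
        (β.naturality f).hom.toNatTrans.app ((α.app a).toFunctor.obj y) := by
  change 𝟙 _ ≫ (β.app b).toFunctor.map ((α.naturality f).hom.toNatTrans.app y) ≫ 𝟙 _ ≫
        (β.naturality f).hom.toNatTrans.app ((α.app a).toFunctor.obj y) ≫ 𝟙 _ = _
  simp only [Category.id_comp, Category.comp_id]

variable {C} in
lemma Ps.id_naturality_app (H : Ps.{v, u} C) {a b : LocallyDiscrete Cᵒᵖ} (f : a ⟶ b)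
    (y : H.obj a) :
    ((Pseudofunctor.StrongTrans.id H).naturality f).hom.toNatTrans.app y =
      𝟙 ((H.map f).toFunctor.obj y) := by
  change 𝟙 _ ≫ 𝟙 _ = _
  exact Category.id_comp _

open scoped Pseudofunctor.StrongTrans in
/-- The category `Ps[Cᵒᵖ, Cat]`: the morphisms are pseudo-natural transformations. -/
instance Ps.category : Category (Ps.{v, u} C) where
  Hom H K := Pseudofunctor.StrongTrans H K
  id H := Pseudofunctor.StrongTrans.id H
  comp α β := Pseudofunctor.StrongTrans.vcomp α β
  id_comp {H K} α := by
    refine Ps.strongTrans_ext rfl (heq_of_eq ?_)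
    funext a b f
    ext y
    refine (Ps.vcomp_naturality_app _ _ f y).trans ?_
    rw [Ps.id_naturality_app]
    exact (congrArg (· ≫ _) ((α.app b).toFunctor.map_id _)).trans (Category.id_comp _)
  comp_id {H K} α := by
    refine Ps.strongTrans_ext rfl (heq_of_eq ?_)
    funext a b f
    ext y
    refine (Ps.vcomp_naturality_app _ _ f y).trans ?_
    rw [Ps.id_naturality_app]
    exact Category.comp_id _
  assoc {H K L M} α β γ := by
    refine Ps.strongTrans_ext rfl (heq_of_eq ?_)
    funext a b f
    ext y
    refine (Ps.vcomp_naturality_app _ _ f y).trans ?_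
    refine Eq.trans ?_ (Ps.vcomp_naturality_app α (β.vcomp γ) f y).symm
    rw [Ps.vcomp_naturality_app]
    refine Eq.trans ?_ (congrArg (_ ≫ ·) (Ps.vcomp_naturality_app β γ f _)).symm
    refine (congrArg (· ≫ _) ((γ.app b).toFunctor.map_comp _ _)).trans (Category.assoc _ _ _)

variable {C}

namespace Ps

variable (H : Ps.{v, u} C)

/-- The value of a pseudofunctor at an object of `C`. -/
abbrev ob (k : C) : Cat.{v, u} := H.obj ⟨op k⟩

/-- The functor `H(u) : H_k ⥤ H_l` for `u : l ⟶ k` in `C`. -/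
abbrev res {l k : C} (f : l ⟶ k) : H.ob k ⥤ H.ob l := (H.map f.op.toLoc).toFunctor

/-- The coherence isomorphism `H(u ≫ f) ≅ H(u) H(f)`. -/
def resComp {m l k : C} (w : m ⟶ l) (f : l ⟶ k) (y : H.ob k) :
    (H.res (w ≫ f)).obj y ≅ (H.res w).obj ((H.res f).obj y) :=
  (Cat.Hom.toNatIso (H.mapComp f.op.toLoc w.op.toLoc)).app y

/-- The coherence isomorphism `H(𝟙) ≅ 𝟙`. -/
def resId {k : C} (y : H.ob k) : (H.res (𝟙 k)).obj y ≅ y :=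
  (Cat.Hom.toNatIso (H.mapId ⟨op k⟩)).app y

variable {H} in
/-- The coherence isomorphism `α_l H(f) ≅ K(f) α_k` of a pseudo-natural transformation. -/
def natIso {H K : Ps.{v, u} C} (α : H ⟶ K) {l k : C} (f : l ⟶ k) (y : H.ob k) :
    (α.app ⟨op l⟩).toFunctor.obj ((H.res f).obj y) ≅
      (K.res f).obj ((α.app ⟨op k⟩).toFunctor.obj y) :=
  (Cat.Hom.toNatIso (α.naturality f.op.toLoc)).app y

lemma resComp_naturality {m l k : C} (w : m ⟶ l) (f : l ⟶ k) {y z : H.ob k} (φ : y ⟶ z) :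
    (H.res (w ≫ f)).map φ ≫ (H.resComp w f z).hom =
      (H.resComp w f y).hom ≫ (H.res w).map ((H.res f).map φ) :=
  (Cat.Hom.toNatIso (H.mapComp f.op.toLoc w.op.toLoc)).hom.naturality φ

lemma resId_naturality {k : C} {y z : H.ob k} (φ : y ⟶ z) :
    (H.res (𝟙 k)).map φ ≫ (H.resId z).hom = (H.resId y).hom ≫ φ :=
  (Cat.Hom.toNatIso (H.mapId ⟨op k⟩)).hom.naturality φ

lemma resComp_id {l k : C} (f : l ⟶ k) (y : H.ob k) :
    (H.resComp (𝟙 l) f y).hom =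
      eqToHom (by rw [Category.id_comp]) ≫ (H.resId ((H.res f).obj y)).inv := by
  have := congr($(H.mapComp_id_right_hom f.op.toLoc).toNatTrans.app y)
  refine this.trans ?_
  have e : (ρ_ f.op.toLoc).hom = eqToHom (Bicategory.Strict.comp_id _) := Subsingleton.elim _ _
  rw [e, PrelaxFunctor.map₂_eqToHom]
  simp [resId]
  rfl

lemma resComp_assoc {n m l k : C} (w' : n ⟶ m) (w : m ⟶ l) (f : l ⟶ k) (y : H.ob k) :
    (H.resComp (w' ≫ w) f y).hom ≫ (H.resComp w' w ((H.res f).obj y)).hom =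
      eqToHom (by rw [Category.assoc]) ≫ (H.resComp w' (w ≫ f) y).hom ≫
        (H.res w').map (H.resComp w f y).hom := by
  have := congr($(H.mapComp_assoc_right_hom f.op.toLoc w.op.toLoc w'.op.toLoc).toNatTrans.app y)
  refine this.trans ?_
  have e : (α_ f.op.toLoc w.op.toLoc w'.op.toLoc).inv = eqToHom (Bicategory.Strict.assoc _ _ _).symm :=
    Subsingleton.elim _ _
  rw [e, PrelaxFunctor.map₂_eqToHom]
  simp [resComp]
  rfl


lemma natIso_naturality {H K : Ps.{v, u} C} (α : H ⟶ K) {l k : C} (f : l ⟶ k) {y z : H.ob k}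
    (φ : y ⟶ z) :
    (α.app ⟨op l⟩).toFunctor.map ((H.res f).map φ) ≫ (natIso α f z).hom =
      (natIso α f y).hom ≫ (K.res f).map ((α.app ⟨op k⟩).toFunctor.map φ) :=
  (Cat.Hom.toNatIso (α.naturality f.op.toLoc)).hom.naturality φ

lemma natIso_comp {H K : Ps.{v, u} C} (α : H ⟶ K) {m l k : C} (w : m ⟶ l) (f : l ⟶ k)
    (y : H.ob k) :
    (natIso α (w ≫ f) y).hom ≫ (K.resComp w f ((α.app ⟨op k⟩).toFunctor.obj y)).hom =
      (α.app ⟨op m⟩).toFunctor.map (H.resComp w f y).hom ≫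
        (natIso α w ((H.res f).obj y)).hom ≫ (K.res w).map (natIso α f y).hom := by
  have := congr($(α.naturality_comp f.op.toLoc w.op.toLoc).toNatTrans.app y)
  refine this.trans ?_
  simp [natIso, resComp]
  rfl

lemma natIso_id (H : Ps.{v, u} C) {l k : C} (f : l ⟶ k) (y : H.ob k) :
    (natIso (𝟙 H) f y).hom = 𝟙 ((H.res f).obj y) :=
  Ps.id_naturality_app H _ y

lemma natIso_vcomp {H K L : Ps.{v, u} C} (α : H ⟶ K) (β : K ⟶ L) {l k : C} (f : l ⟶ k)
    (y : H.ob k) :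
    (natIso (α ≫ β) f y).hom =
      (β.app ⟨op l⟩).toFunctor.map (natIso α f y).hom ≫ 
        (natIso β f ((α.app ⟨op k⟩).toFunctor.obj y)).hom :=
  Ps.vcomp_naturality_app α β _ y


/-- The objects of the category `L_k = (St H)_k`. These are the objects of the coproduct
`(TUH)_k = ∐_r ∐_{C(k, r)} H_r`. -/
structure StOb (k : C) where
  /-- the index `r` of the summand -/
  idx : C
  /-- the index `f : k ⟶ r` of the summand -/
  arr : k ⟶ idx
  /-- an object of `H_r` -/
  pt : H.ob idx

variable {H} in
/-- The value of the structure map `h_k : (TUH)_k ⥤ H_k` on objects, sending `y` in the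
summand indexed by `f : k ⟶ r` to `H(f) y`. -/
abbrev StOb.val {k : C} (x : H.StOb k) : H.ob k := (H.res x.arr).obj x.pt

/-- The morphisms of the category `L_k = (St H)_k`: as `(TUH)_k ⥤ L_k` is bijective on objects
and `L_k ⥤ H_k` is fully faithful, these are the morphisms of `H_k` between the values of
`h_k`. -/
@[ext]
structure StHom {k : C} (x y : H.StOb k) where
  /-- the underlying morphism of `H_k` -/
  val : x.val ⟶ y.val

instance (k : C) : Category (H.StOb k) where
  Hom x y := H.StHom x y
  id _ := ⟨𝟙 _⟩
  comp φ ψ := ⟨φ.val ≫ ψ.val⟩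
  id_comp _ := StHom.ext (Category.id_comp _)
  comp_id _ := StHom.ext (Category.comp_id _)
  assoc _ _ _ := StHom.ext (Category.assoc _ _ _)

@[simp] lemma StHom.id_val {k : C} (x : H.StOb k) : StHom.val (𝟙 x) = 𝟙 x.val := rfl

@[simp] lemma StHom.comp_val {k : C} {x y z : H.StOb k} (φ : x ⟶ y) (ψ : y ⟶ z) :
    StHom.val (φ ≫ ψ) = StHom.val φ ≫ StHom.val ψ := rfl

lemma StHom.eqToHom_val {k : C} {x y : H.StOb k} (h : x = y) :
    StHom.val (eqToHom h) = eqToHom (by rw [h]) := by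
  subst h; rfl

@[ext]
lemma StHom.hom_ext {k : C} {x y : H.StOb k} {φ ψ : x ⟶ y} (h : StHom.val φ = StHom.val ψ) :
    φ = ψ := StHom.ext h

/-- The functor `L(w) : L_k ⥤ L_m` for `w : m ⟶ k`. On objects it is the action of `w` on the free
algebra `TUH`, on morphisms it is `H(w)` conjugated by the coherence isomorphisms of `H`. -/
@[simps]
def stRes {m k : C} (w : m ⟶ k) : H.StOb k ⥤ H.StOb m where
  obj x := ⟨x.idx, w ≫ x.arr, x.pt⟩
  map {x y} φ := ⟨(H.resComp w x.arr x.pt).hom ≫ (H.res w).map φ.val ≫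
    (H.resComp w y.arr y.pt).inv⟩
  map_id x := by
    ext
    simp
  map_comp φ ψ := by
    ext
    simp

lemma stFunctor_ext {A : Type*} [Category* A] {k : C} {F G : A ⥤ H.StOb k}
    (h : ∀ x, F.obj x = G.obj x)
    (h' : ∀ (x y : A) (φ : x ⟶ y), StHom.val (F.map φ) =
      eqToHom (by rw [h]) ≫ StHom.val (G.map φ) ≫ eqToHom (by rw [h])) : F = G := by
  refine CategoryTheory.Functor.ext h fun x y φ => StHom.hom_ext _ ?_
  rw [h', StHom.comp_val, StHom.comp_val, StHom.eqToHom_val, StHom.eqToHom_val]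

lemma stRes_id (k : C) : H.stRes (𝟙 k) = 𝟭 _ := by
  refine H.stFunctor_ext (fun x => ?_) (fun x x' φ => ?_)
  · obtain ⟨r, f, z⟩ := x
    simp [stRes]
  · obtain ⟨r, f, y⟩ := x
    obtain ⟨r', f', y'⟩ := x'
    obtain ⟨φ⟩ := φ
    have h1 := H.resComp_id f y
    have h2 : H.resComp (𝟙 k) f' y' =
      eqToIso (by rw [Category.id_comp]) ≪≫ (H.resId ((H.res f').obj y')).symm :=
      Iso.ext (H.resComp_id f' y')
    change (H.resComp (𝟙 k) f y).hom ≫ (H.res (𝟙 k)).map φ ≫ (H.resComp (𝟙 k) f' y').inv = 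
      eqToHom _ ≫ φ ≫ eqToHom _
    rw [h1, h2]
    simp only [Iso.trans_inv, Iso.symm_inv, eqToIso.inv, Category.assoc]
    rw [← Category.assoc ((H.res (𝟙 k)).map φ), resId_naturality]
    simp

lemma resComp_conj {n m k r r' : C} (w' : n ⟶ m) (w : m ⟶ k) (f : k ⟶ r) (f' : k ⟶ r')
    {y : H.ob r} {y' : H.ob r'} (φ : (H.res f).obj y ⟶ (H.res f').obj y') :
    (H.resComp (w' ≫ w) f y).hom ≫ (H.res (w' ≫ w)).map φ ≫ (H.resComp (w' ≫ w) f' y').inv =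
      eqToHom (by rw [Category.assoc]) ≫ ((H.resComp w' (w ≫ f) y).hom ≫
        (H.res w').map ((H.resComp w f y).hom ≫ (H.res w).map φ ≫ (H.resComp w f' y').inv) ≫
          (H.resComp w' (w ≫ f') y').inv) ≫ eqToHom (by rw [Category.assoc]) := by
  have h1 := H.resComp_assoc w' w f y
  have h2 := H.resComp_assoc w' w f' y'
  rw [← Category.assoc, Iso.comp_inv_eq, ← cancel_mono (H.resComp w' w ((H.res f').obj y')).hom]
  simp only [Category.assoc, Functor.map_comp, resComp_naturality, h2]
  rw [reassoc_of% h1]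
  simp

lemma stRes_comp {n m k : C} (w' : n ⟶ m) (w : m ⟶ k) :
    H.stRes (w' ≫ w) = H.stRes w ⋙ H.stRes w' := by
  refine H.stFunctor_ext (fun x => ?_) (fun x x' φ => ?_)
  · obtain ⟨r, f, z⟩ := x
    simp [stRes]
  · obtain ⟨r, f, y⟩ := x
    obtain ⟨r', f', y'⟩ := x'
    obtain ⟨φ⟩ := φ
    exact H.resComp_conj w' w f f' φ

/-- The strictification `St H : Cᵒᵖ ⥤ Cat` of a pseudofunctor `H`. -/
def stObj : Cᵒᵖ ⥤ Cat.{v, u} where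
  obj k := Cat.of (H.StOb k.unop)
  map w := (H.stRes w.unop).toCatHom
  map_id k := congrArg Functor.toCatHom (H.stRes_id k.unop)
  map_comp w w' := congrArg Functor.toCatHom (H.stRes_comp w'.unop w.unop)

variable {H} in
/-- The functor `(St H)_k ⥤ (St K)_k` induced by a pseudo-natural transformation `α : H ⟶ K`. -/
def stMapApp {H K : Ps.{v, u} C} (α : H ⟶ K) (k : C) : H.StOb k ⥤ K.StOb k where
  obj x := ⟨x.idx, x.arr, (α.app ⟨op x.idx⟩).toFunctor.obj x.pt⟩
  map {x y} φ := ⟨(natIso α x.arr x.pt).inv ≫ (α.app ⟨op k⟩).toFunctor.map φ.val ≫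
    (natIso α y.arr y.pt).hom⟩
  map_id x := by
    ext
    simp
  map_comp φ ψ := by
    ext
    simp

/-- The strictification functor `St : Ps[Cᵒᵖ, Cat] ⥤ [Cᵒᵖ, Cat]`. -/
def St : Ps.{v, u} C ⥤ (Cᵒᵖ ⥤ Cat.{v, u}) where
  obj H := H.stObj
  map {H K} α :=
    { app k := (stMapApp α k.unop).toCatHom
      naturality k l w := by
        refine congrArg Functor.toCatHom (CategoryTheory.Functor.hext (fun x => rfl)
          (fun x y φ => heq_of_eq (StHom.hom_ext _ ?_)))
        change (natIso α (w.unop ≫ x.arr) x.pt).inv ≫ (α.app ⟨op l.unop⟩).toFunctor.map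
            ((H.resComp w.unop x.arr x.pt).hom ≫ (H.res w.unop).map φ.val ≫
              (H.resComp w.unop y.arr y.pt).inv) ≫ (natIso α (w.unop ≫ y.arr) y.pt).hom =
          (K.resComp w.unop x.arr ((α.app ⟨op x.idx⟩).toFunctor.obj x.pt)).hom ≫
            (K.res w.unop).map ((natIso α x.arr x.pt).inv ≫
              (α.app ⟨op k.unop⟩).toFunctor.map φ.val ≫ (natIso α y.arr y.pt).hom) ≫
            (K.resComp w.unop y.arr ((α.app ⟨op y.idx⟩).toFunctor.obj y.pt)).inv
        have h1 := natIso_comp α w.unop x.arr x.pt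
        have h2 := natIso_comp α w.unop y.arr y.pt
        rw [Iso.inv_comp_eq, reassoc_of% h1, ← Category.assoc, ← cancel_mono (K.resComp _ _ _).hom]
        simp only [Category.assoc, h2, Functor.map_comp]
        have h3 := natIso_naturality α w.unop φ.val
        simp [reassoc_of% h3] }
  map_id H := by
    ext k : 2
    refine congrArg Functor.toCatHom (CategoryTheory.Functor.hext (fun x => rfl)
          (fun x y φ => heq_of_eq (StHom.hom_ext _ ?_)))
    change (natIso (𝟙 H) x.arr x.pt).inv ≫ φ.val ≫ (natIso (𝟙 H) y.arr y.pt).hom = φ.val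
    have e (z : H.StOb k.unop) : natIso (𝟙 H) z.arr z.pt = Iso.refl z.val :=
      Iso.ext (natIso_id H z.arr z.pt)
    rw [e x, e y]
    exact (Category.id_comp _).trans (Category.comp_id _)
  map_comp {H K L} α β := by
    ext k : 2
    refine congrArg Functor.toCatHom (CategoryTheory.Functor.hext (fun x => rfl)
          (fun x y φ => heq_of_eq (StHom.hom_ext _ ?_)))
    change (natIso (α ≫ β) x.arr x.pt).inv ≫ 
        (β.app ⟨op k.unop⟩).toFunctor.map ((α.app ⟨op k.unop⟩).toFunctor.map φ.val) ≫
          (natIso (α ≫ β) y.arr y.pt).hom =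
      (natIso β x.arr _).inv ≫ (β.app ⟨op k.unop⟩).toFunctor.map
        ((natIso α x.arr x.pt).inv ≫ (α.app ⟨op k.unop⟩).toFunctor.map φ.val ≫
          (natIso α y.arr y.pt).hom) ≫ (natIso β y.arr _).hom
    have e (z : H.StOb k.unop) : natIso (α ≫ β) z.arr z.pt =
        (β.app ⟨op k.unop⟩).toFunctor.mapIso (natIso α z.arr z.pt) ≪≫
          natIso β z.arr ((α.app ⟨op z.idx⟩).toFunctor.obj z.pt) :=
      Iso.ext (natIso_vcomp α β z.arr z.pt)
    rw [e x, e y]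
    simp only [Functor.map_comp, Category.assoc]
    exact Category.assoc _ _ _

end Ps
end Strictification

/-! ## The fat delta -/

/-- A finite non-empty coloured ordinal: the free coloured (semi-)category on the linear graph with
vertices `0, …, len` and an edge from `j` to `j + 1` for each `j < len`, some of the edges being
coloured. The coloured edges are called links. -/
structure FatDelta : Type where
  /-- the number of edges -/
  len : ℕ
  /-- the edge from `j` to `j + 1` is a link -/
  link : Fin len → Bool

namespace FatDelta

/-- The arrow from the vertex `x` to the vertex `y` (or from `y` to `x`) is coloured, i.e. it is a
composite of links. -/
def Linked (k : FatDelta) (x y : Fin (k.len + 1)) : Prop :=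
  ∀ j : Fin k.len, min x y ≤ j.castSucc → j.succ ≤ max x y → k.link j = true

/-- A morphism in the fat delta: a colour-preserving semi-functor, that is, a strictly monotone map
on vertices which sends coloured arrows to coloured arrows. -/
@[ext]
structure Hom (k l : FatDelta) : Type where
  /-- the map on vertices -/
  toFun : Fin (k.len + 1) → Fin (l.len + 1)
  strictMono : StrictMono toFun
  linked : ∀ x y, k.Linked x y → l.Linked (toFun x) (toFun y)

instance : SmallCategory FatDelta where
  Hom := Hom
  id k := ⟨id, strictMono_id, fun _ _ h => h⟩
  comp f g := ⟨g.toFun ∘ f.toFun, g.strictMono.comp f.strictMono,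
    fun _ _ h => g.linked _ _ (f.linked _ _ h)⟩

@[ext]
lemma hom_ext {k l : FatDelta} {f g : k ⟶ l} (h : f.toFun = g.toFun) : f = g := Hom.ext h

lemma linked_refl (k : FatDelta) (x : Fin (k.len + 1)) : k.Linked x x := by
  intro j h1 h2
  simp only [min_self, max_self] at h1 h2
  exact absurd (h2.trans h1) (by simp)

lemma linked_symm {k : FatDelta} {x y : Fin (k.len + 1)} (h : k.Linked x y) : k.Linked y x := by
  intro j h1 h2
  rw [min_comm] at h1
  rw [max_comm] at h2
  exact h j h1 h2

lemma linked_trans {k : FatDelta} {x y z : Fin (k.len + 1)} (h : k.Linked x y)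
    (h' : k.Linked y z) : k.Linked x z := by
  intro j h1 h2
  have h := h j
  have h' := h' j
  simp only [Fin.le_def, Fin.val_castSucc, Fin.val_succ, Fin.coe_min, Fin.coe_max] at h h' h1 h2
  by_cases c : min (x : ℕ) y ≤ j ∧ (j : ℕ) + 1 ≤ max (x : ℕ) y
  · exact h c.1 c.2
  · exact h' (by omega) (by omega)

/-- Vertices of `k` up to being connected by links. -/
def linkedSetoid (k : FatDelta) : Setoid (Fin (k.len + 1)) where
  r := k.Linked
  iseqv := ⟨k.linked_refl, linked_symm, linked_trans⟩

/-- The set of equiconnected components of `k`, i.e. the underlying set of the ordinal `π(k)`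
obtained by contracting all the links. -/
def Components (k : FatDelta) : Type := Quotient k.linkedSetoid

/-- The map on underlying sets of the monotone map `π(f) : π(k) → π(l)`. -/
def mapComponents {k l : FatDelta} (f : k ⟶ l) : k.Components → l.Components :=
  Quotient.map' f.toFun (fun _ _ h => f.linked _ _ h)

/-- The coloured morphisms of the fat delta: the vertical ones, for which `π(f)` is an isomorphism
(hence an identity) of finite ordinals. -/
def IsVertical {k l : FatDelta} (f : k ⟶ l) : Prop := Function.Bijective (mapComponents f)

/-- The object with a single vertex. -/
def point : FatDelta := ⟨0, fun _ => false⟩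

/-- The object with two vertices and one edge, which is a link if `c = true`. -/
def edge (c : Bool) : FatDelta := ⟨1, fun _ => c⟩

/-- The vertex `x` of `k`, as a morphism. -/
def vertex (k : FatDelta) (x : Fin (k.len + 1)) : point ⟶ k where
  toFun _ := x
  strictMono i j h := absurd h (by
    have hi : (i : ℕ) < 1 := i.2
    have hj : (j : ℕ) < 1 := j.2
    rw [Fin.lt_def]
    omega)
  linked _ _ _ := k.linked_refl x

/-- For vertices `x < y` of `k`, the morphism `edge c ⟶ k` sending `0` to `x` and `1` to `y`;
for `c = true` the arrow from `x` to `y` has to be coloured. -/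
def chord (k : FatDelta) (c : Bool) (x y : Fin (k.len + 1)) (hxy : x < y)
    (h : c = true → k.Linked x y) : edge c ⟶ k where
  toFun := (![x, y] : Fin 2 → Fin (k.len + 1))
  strictMono := by
    have key : ∀ i j : Fin 2, i < j →
        (![x, y] : Fin 2 → Fin (k.len + 1)) i < (![x, y] : Fin 2 → Fin (k.len + 1)) j := by
      simp only [Fin.forall_fin_two]
      simpa using hxy
    exact fun i j hij => key i j hij
  linked := by
    have key : ∀ i j : Fin 2, (i ≠ j → c = true) →
        k.Linked ((![x, y] : Fin 2 → Fin (k.len + 1)) i)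
          ((![x, y] : Fin 2 → Fin (k.len + 1)) j) := by
      simp only [Fin.forall_fin_two]
      exact ⟨⟨fun _ => k.linked_refl x, fun e => h (e (by simp))⟩,
        ⟨fun e => linked_symm (h (e (by simp))), fun _ => k.linked_refl y⟩⟩
    have edge_coloured : ∀ i j : Fin 2, (edge c).Linked i j → i ≠ j → c = true := by
      simp only [Fin.forall_fin_two]
      exact ⟨⟨fun _ e => absurd rfl e, fun e _ => e (0 : Fin 1) (show min (0 : Fin 2) 1 ≤ 0 by decide)
          (show (1 : Fin 2) ≤ max 0 1 by decide)⟩,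
        ⟨fun e _ => e (0 : Fin 1) (show min (1 : Fin 2) 0 ≤ 0 by decide)
          (show (1 : Fin 2) ≤ max 1 0 by decide), fun _ e => absurd rfl e⟩⟩
    exact fun i j hij => key i j (edge_coloured i j hij)

lemma linked_edge (k : FatDelta) (j : Fin k.len) (h : k.link j = true) :
    k.Linked j.castSucc j.succ := by
  intro i h1 h2
  obtain rfl : i = j := by
    simp only [Fin.le_def, Fin.val_castSucc, Fin.val_succ, Fin.coe_min, Fin.coe_max] at h1 h2
    exact Fin.ext (by omega)
  exact h

/-- The inclusion of the `j`-th edge of `k`. -/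
def edgeIncl (k : FatDelta) (j : Fin k.len) : edge (k.link j) ⟶ k :=
  k.chord (k.link j) j.castSucc j.succ Fin.castSucc_lt_succ (k.linked_edge j)

lemma vertex_comp {k l : FatDelta} (x : Fin (k.len + 1)) (f : k ⟶ l) :
    k.vertex x ≫ f = l.vertex (f.toFun x) := rfl

/-- The first vertex of an edge. -/
abbrev src (c : Bool) : point ⟶ edge c := (edge c).vertex (0 : Fin 2)

/-- The last vertex of an edge. -/
abbrev tgt (c : Bool) : point ⟶ edge c := (edge c).vertex (1 : Fin 2)

lemma tgt_edgeIncl {k : FatDelta} {i j : Fin k.len} (h : i.succ = j.castSucc) :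
    tgt _ ≫ k.edgeIncl i = src _ ≫ k.edgeIncl j := by
  refine hom_ext (funext fun _ => ?_)
  exact h

/-- The object with two edges, coloured by `c` and `d`. -/
def twoEdges (c d : Bool) : FatDelta := ⟨2, ![c, d]⟩

/-- The morphism `edge (c && d) ⟶ twoEdges c d` sending `0` to `0` and `1` to `2`; it induces the
composition maps. -/
def outer (c d : Bool) : edge (c && d) ⟶ twoEdges c d :=
  (twoEdges c d).chord (c && d) (0 : Fin 3) (2 : Fin 3) (show (0 : Fin 3) < 2 by decide) (by
    intro h
    obtain ⟨rfl, rfl⟩ : c = true ∧ d = true := by simpa using h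
    intro j _ _
    change ![true, true] j = true
    fin_cases j <;> rfl)

end FatDelta

/-! ## Segal maps -/

section Segal

/-- A functor is an isomorphism of categories. -/
def IsIsoOfCategories {A B : Type*} [Category* A] [Category* B] (F : A ⥤ B) : Prop :=
  ∃ G : B ⥤ A, F ⋙ G = 𝟭 A ∧ G ⋙ F = 𝟭 B

/-- Given categories and functors `s j, t j : A j ⥤ B`, for `0 ≤ j < n`, an object of the iterated
(strict) pullback `A 0 ×_B A 1 ×_B ⋯ ×_B A (n - 1)`, formed using `t i` and `s (i + 1)`. -/
structure IterPullback {n : ℕ} {A : Fin n → Type*} [∀ j, Category* (A j)] {B : Type*}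
    [Category* B] (s t : ∀ j, A j ⥤ B) where
  /-- the components -/
  ob : ∀ j, A j
  compat : ∀ i j : Fin n, (i : ℕ) + 1 = j → (t i).obj (ob i) = (s j).obj (ob j)

namespace IterPullback

variable {n : ℕ} {A : Fin n → Type*} [∀ j, Category* (A j)] {B : Type*} [Category* B]
  {s t : ∀ j, A j ⥤ B}

/-- A morphism of the iterated strict pullback. -/
@[ext]
structure Hom (x y : IterPullback s t) where
  /-- the components -/
  mor : ∀ j, x.ob j ⟶ y.ob j
  compat : ∀ (i j : Fin n) (h : (i : ℕ) + 1 = j), (t i).map (mor i) =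
    eqToHom (x.compat i j h) ≫ (s j).map (mor j) ≫ eqToHom (y.compat i j h).symm

instance : Category (IterPullback s t) where
  Hom := Hom
  id x := ⟨fun j => 𝟙 (x.ob j), fun i j h => by simp⟩
  comp f g := ⟨fun j => f.mor j ≫ g.mor j, fun i j h => by
    simp [f.compat i j h, g.compat i j h]⟩
  id_comp f := Hom.ext (funext fun j => Category.id_comp _)
  comp_id f := Hom.ext (funext fun j => Category.comp_id _)
  assoc f g h := Hom.ext (funext fun j => Category.assoc _ _ _)

/-- The functor into the iterated pullback determined by a compatible family of functors. -/
def lift {D : Type*} [Category* D] (F : ∀ j, D ⥤ A j)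
    (hF : ∀ i j : Fin n, (i : ℕ) + 1 = j → F i ⋙ t i = F j ⋙ s j) : D ⥤ IterPullback s t where
  obj x := ⟨fun j => (F j).obj x, fun i j h => Functor.congr_obj (hF i j h) x⟩
  map φ := ⟨fun j => (F j).map φ, fun i j h => Functor.congr_hom (hF i j h) φ⟩
  map_id x := Hom.ext (funext fun j => (F j).map_id x)
  map_comp φ ψ := Hom.ext (funext fun j => (F j).map_comp φ ψ)

/-- The functor `A 0 ×_B ⋯ ×_B A (n - 1) ⥤ A 0 ×_{B'} ⋯ ×_{B'} A (n - 1)` induced by `γ : B ⥤ B'`. -/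
def changeBase (s t : ∀ j, A j ⥤ B) {B' : Type*} [Category* B'] (γ : B ⥤ B') :
    IterPullback s t ⥤ IterPullback (fun j => s j ⋙ γ) (fun j => t j ⋙ γ) where
  obj x := ⟨x.ob, fun i j h => congrArg γ.obj (x.compat i j h)⟩
  map φ := ⟨φ.mor, fun i j h => by
    simp [φ.compat i j h, eqToHom_map]⟩
  map_id x := rfl
  map_comp φ ψ := rfl

end IterPullback

end Segal

/-! ## Homotopically discrete categories -/

/-- A homotopically discrete category: an equivalence relation, i.e. a groupoid with no non-trivial
loops. -/
structure IsHomotopicallyDiscrete (A : Type*) [Category* A] : Prop where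
  isGroupoid : IsGroupoid A
  loop : ∀ (x : A) (f : x ⟶ x), f = 𝟙 x

/-- The discrete category `A^d` on the set of isomorphism classes of objects of `A`. -/
abbrev DiscreteIsoClasses (A : Type*) [Category* A] := Discrete (Quotient (isIsomorphicSetoid A))

/-- The discretization functor `γ : A ⥤ A^d` of a groupoid. -/
def discretization (A : Type*) [Category* A] [IsGroupoid A] : A ⥤ DiscreteIsoClasses A where
  obj x := ⟨Quotient.mk (isIsomorphicSetoid A) x⟩
  map f := Discrete.eqToHom (Quotient.sound ⟨asIso f⟩)

/-! ## Weakly globular fair `2`-categories -/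

namespace FatDelta

variable (X : FatDeltaᵒᵖ ⥤ Cat.{v, u})

/-- The functor `X(f) : X_l ⥤ X_k` for `f : k ⟶ l` in the fat delta. -/
abbrev act {k l : FatDelta} (f : k ⟶ l) : X.obj (op l) ⥤ X.obj (op k) := (X.map f.op).toFunctor

/-- The `k`-th Segal map `X_k ⥤ X_{~1} ×_{X_0} ⋯ ×_{X_0} X_{~1}`, with one factor for each edge
of `k`: the factor is `X_1` for an uncoloured edge and `X_U`, with `U` the object consisting
of one link, for a link. -/
def segalMap (k : FatDelta) :
    X.obj (op k) ⥤ IterPullback (fun j : Fin k.len => act X (src (k.link j)))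
      (fun j : Fin k.len => act X (tgt (k.link j))) :=
  IterPullback.lift (fun j => act X (k.edgeIncl j)) (fun i j h => by
    have e := tgt_edgeIncl (k := k) (i := i) (j := j) (Fin.ext h)
    have := congr((X.map ($e).op).toFunctor)
    simpa only [op_comp, Functor.map_comp, Cat.Hom.comp_toFunctor] using this)

/-- The induced Segal map `X_{~1} ×_{X_0} ⋯ ×_{X_0} X_{~1} ⥤ X_{~1} ×_{X_0^d} ⋯ ×_{X_0^d} X_{~1}`. -/
def inducedSegalMap [IsGroupoid (X.obj (op point))] (k : FatDelta) :=
  IterPullback.changeBase (fun j : Fin k.len => act X (src (k.link j)))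
    (fun j : Fin k.len => act X (tgt (k.link j))) (discretization (X.obj (op point)))

/-- Weakly globular fair `2`-categories. -/
structure IsWeaklyGlobularFair : Prop where
  homotopicallyDiscrete : IsHomotopicallyDiscrete (X.obj (op point))
  segal : ∀ k : FatDelta, 2 ≤ k.len → IsIsoOfCategories (segalMap X k)
  inducedSegal : ∀ k : FatDelta, 2 ≤ k.len →
    haveI := homotopicallyDiscrete.isGroupoid
    (inducedSegalMap X k).IsEquivalence
  colours : ∀ {k l : FatDelta} (f : k ⟶ l), IsVertical f → (act X f).IsEquivalence

/-! ## Segalic pseudofunctors -/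

/-- If `H_0` is discrete, the two composites `H_k ⥤ H_{~1} ⥤ H_0` through consecutive edges of `k`
coincide. -/
lemma ps_compat (H : Ps.{v, u} FatDelta) [IsDiscrete (H.ob point)] {k : FatDelta}
    {i j : Fin k.len} (h : i.succ = j.castSucc) :
    H.res (k.edgeIncl i) ⋙ H.res (tgt _) = H.res (k.edgeIncl j) ⋙ H.res (src _) := by
  refine CategoryTheory.Functor.ext (fun x => ?_) (fun _ _ _ => Subsingleton.elim _ _)
  refine obj_ext_of_isDiscrete ((H.resComp (tgt _) (k.edgeIncl i) x).inv ≫ eqToHom ?_ ≫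
    (H.resComp (src _) (k.edgeIncl j) x).hom)
  rw [tgt_edgeIncl h]

/-- The `k`-th Segal map `H_k ⥤ H_{~1} ×_{H_0} ⋯ ×_{H_0} H_{~1}` of a pseudofunctor with `H_0`
discrete, with one factor for each edge of `k`. -/
def psSegalMap (H : Ps.{v, u} FatDelta) [IsDiscrete (H.ob point)] (k : FatDelta) :
    H.ob k ⥤ IterPullback (fun j : Fin k.len => H.res (src (k.link j)))
      (fun j : Fin k.len => H.res (tgt (k.link j))) :=
  IterPullback.lift (fun j => H.res (k.edgeIncl j)) (fun _ _ h => ps_compat H (Fin.ext h))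

/-- Segalic pseudofunctors from the opposite of the fat delta to `Cat`. -/
structure IsSegalic (H : Ps.{v, u} FatDelta) : Prop where
  discrete : IsDiscrete (H.ob point)
  segal : ∀ k : FatDelta, 2 ≤ k.len → IsIsoOfCategories (psSegalMap H k)
  src_unit : (H.res (src true)).IsEquivalence
  tgt_unit : (H.res (tgt true)).IsEquivalence
  comp_unit_arrow : (H.res (outer true false)).IsEquivalence
  comp_arrow_unit : (H.res (outer false true)).IsEquivalence
  comp_unit_unit : (H.res (outer true true)).IsEquivalence

end FatDelta

/-- The category `SegPs[Δ̲ᵒᵖ, Cat]`, as a full subcategory of `Ps[Δ̲ᵒᵖ, Cat]`. -/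
abbrev SegPs : ObjectProperty (Ps.{v, u} FatDelta) := FatDelta.IsSegalic

/-- The category of weakly globular fair `2`-categories, as a full subcategory of
`[Δ̲ᵒᵖ, Cat]`. -/
abbrev FairWG : ObjectProperty (FatDeltaᵒᵖ ⥤ Cat.{v, u}) := FatDelta.IsWeaklyGlobularFair

/-!
The strictification `L = St H` is levelwise equivalent to `H`: by construction `L_k ⥤ H_k` is fully
faithful, it is essentially surjective because `(k, 𝟙, y)` lies over `H(𝟙) y ≅ y`, and the coherence
isomorphisms of `H` make these functors pseudo-natural in `k` (`Ps.stCounit`). So `L(w)` is an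
equivalence as soon as `H(w)` is one. It remains to see that `L` is a weakly globular fair
`2`-category when `H` is Segalic.

* `L_0` is homotopically discrete, since its morphisms are morphisms of the discrete category `H_0`.
* The Segal maps of `L` are fully faithful since those of `H` are, and they are bijective on objects
  since an object of `L_k` is a morphism `k ⟶ r` together with a point of `H_r`, and `k` is the
  colimit of its edges (`FatDelta.isIso_segalMap`).
* The induced Segal maps are fully faithful as `L_0` and its discretization have no distinct
  parallel morphisms. For essential surjectivity, the values in `H` of a family of edges composable
  over `L_0^d` are strictly composable, as `H_0` is discrete; by the Segal condition for `H` they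
  come from some `b` in `H_k`, and `(k, 𝟙, b)` is a preimage
  (`FatDelta.isEquivalence_inducedSegalMap`).
* `H`, hence `L`, sends vertical morphisms to equivalences (`FatDelta.IsSegalic.isEquivalence_res`).
  By the Segal condition `H` sends a concatenation of two coloured ordinals to a fibre product over
  `H_0`, up to equivalence (`FatDelta.IsSegalic.isGlued_join`), and equivalences glue along such
  fibre products (`Ps.IsGlued.isEquivalence_res`). An induction on the length of the target then
  reduces a vertical morphism to the two vertices of a link and to the subdivisions of an edge into
  two edges at least one of which is a link, on which `H` is an equivalence by assumption.
-/

/-! ### Jointly fully faithful families of functors -/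

section JointlyFullyFaithful

variable {J : Type*} {A : Type*} [Category* A] {B : J → Type*} [∀ j, Category* (B j)]

/-- The functors `F j : A ⥤ B j` are jointly fully faithful: the map
`Hom a b → ∏ j, Hom (F j a) (F j b)` is bijective for all objects `a`, `b` of `A`. -/
structure JointlyFullyFaithful (F : ∀ j, A ⥤ B j) : Prop where
  faithful : ∀ {a b : A} (φ ψ : a ⟶ b), (∀ j, (F j).map φ = (F j).map ψ) → φ = ψ
  full : ∀ {a b : A} (φ : ∀ j, (F j).obj a ⟶ (F j).obj b), ∃ ψ : a ⟶ b, ∀ j, (F j).map ψ = φ j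

lemma JointlyFullyFaithful.nonempty_iso {F : ∀ j, A ⥤ B j} (hF : JointlyFullyFaithful F) {a b : A}
    (e : ∀ j, Nonempty ((F j).obj a ≅ (F j).obj b)) : Nonempty (a ≅ b) := by
  have e := fun j => (e j).some
  obtain ⟨φ, hφ⟩ := hF.full fun j => (e j).hom
  obtain ⟨ψ, hψ⟩ := hF.full fun j => (e j).inv
  exact ⟨⟨φ, ψ, hF.faithful _ _ fun j => by simp [hφ, hψ],
    hF.faithful _ _ fun j => by simp [hφ, hψ]⟩⟩

end JointlyFullyFaithful

namespace Ps

variable {C : Type} [SmallCategory C] (H : Ps.{v, u} C)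

/-! ### Restriction functors of a pseudofunctor -/

/-- For a commutative triangle `w ≫ f = g`, the coherence isomorphism `H(g) ≅ H(w) H(f)`. -/
def resTriangle {m l k : C} {w : m ⟶ l} {f : l ⟶ k} {g : m ⟶ k} (h : w ≫ f = g) :
    H.res g ≅ H.res f ⋙ H.res w :=
  eqToIso (by rw [← h]; rfl) ≪≫ Cat.Hom.toNatIso (H.mapComp f.op.toLoc w.op.toLoc)

/-- For a commutative square, the coherence isomorphism between the two composites of
restriction functors. -/
def resSquare {m l l' k : C} {w : m ⟶ l} {f : l ⟶ k} {w' : m ⟶ l'} {f' : l' ⟶ k}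
    (h : w ≫ f = w' ≫ f') : H.res f ⋙ H.res w ≅ H.res f' ⋙ H.res w' :=
  (H.resTriangle h).symm ≪≫ H.resTriangle rfl

/-- The coherence isomorphism `H(𝟙) ≅ 𝟭`. -/
def resIdIso (k : C) : H.res (𝟙 k) ≅ 𝟭 (H.ob k) := Cat.Hom.toNatIso (H.mapId ⟨op k⟩)

lemma isEquivalence_res_comp {m l k : C} (w : m ⟶ l) (f : l ⟶ k) [(H.res w).IsEquivalence]
    [(H.res f).IsEquivalence] : (H.res (w ≫ f)).IsEquivalence :=
  Functor.isEquivalence_of_iso (H.resTriangle (w := w) (f := f) rfl).symm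

lemma isEquivalence_res_of_isIso {l k : C} (f : l ⟶ k) [IsIso f] : (H.res f).IsEquivalence :=
  (CategoryTheory.Equivalence.mk (H.res f) (H.res (inv f))
    ((H.resIdIso k).symm ≪≫ H.resTriangle (IsIso.inv_hom_id f))
    ((H.resTriangle (IsIso.hom_inv_id f)).symm ≪≫ H.resIdIso l)).isEquivalence_functor

lemma res_obj_res_obj {m l k : C} [IsDiscrete (H.ob m)] {w : m ⟶ l} {f : l ⟶ k} {g : m ⟶ k}
    (h : w ≫ f = g) (a : H.ob k) : (H.res w).obj ((H.res f).obj a) = (H.res g).obj a :=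
  obj_ext_of_isDiscrete ((H.resTriangle h).inv.app a)

lemma res_obj_eq_of_comm {m l l' k : C} [IsDiscrete (H.ob m)] {w : m ⟶ l} {f : l ⟶ k}
    {w' : m ⟶ l'} {f' : l' ⟶ k} (h : w ≫ f = w' ≫ f') (a : H.ob k) :
    (H.res w).obj ((H.res f).obj a) = (H.res w').obj ((H.res f').obj a) :=
  (H.res_obj_res_obj h a).trans (H.res_obj_res_obj rfl a).symm

/-! ### Gluing equivalences along pullbacks over a discrete category -/

/-- A family of morphisms `i t : kk t ⟶ k`, with `v t : p ⟶ kk t` such that all the `v t ≫ i t`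
coincide, is glued for `H` if, up to equivalence, `H_k` is the fibre product of the `H_{kk t}`
over `H_p`, for discrete `H_p`. -/
structure IsGlued {T : Type*} {kk : T → C} {k p : C} (i : ∀ t, kk t ⟶ k) (v : ∀ t, p ⟶ kk t) :
    Prop where
  comm : ∀ t t', v t ≫ i t = v t' ≫ i t'
  fullyFaithful : JointlyFullyFaithful fun t => H.res (i t)
  exists_obj : ∀ a : (∀ t, H.ob (kk t)),
    (∀ t t', (H.res (v t)).obj (a t) = (H.res (v t')).obj (a t')) →
      ∃ b : H.ob k, ∀ t, Nonempty ((H.res (i t)).obj b ≅ a t)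

variable {H}

/-- Joint full faithfulness on the family of composites `e t s ≫ i t` descends to the family
`i`. -/
lemma jointlyFullyFaithful_of_comp {T : Type*} {S : T → Type*} {kk : T → C} {k : C}
    {i : ∀ t, kk t ⟶ k} {ee : ∀ t, S t → C} {e : ∀ t s, ee t s ⟶ kk t}
    (h : ∀ t, JointlyFullyFaithful fun s => H.res (e t s))
    (h' : JointlyFullyFaithful fun x : (Σ t, S t) => H.res (e x.1 x.2 ≫ i x.1)) :
    JointlyFullyFaithful fun t => H.res (i t) := by
  have nat (t : T) (s : S t) {a b : H.ob k} (φ : a ⟶ b) :=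
    (H.resTriangle (w := e t s) (f := i t) rfl).hom.naturality φ
  refine ⟨fun {a b} φ ψ hφ => h'.faithful _ _ fun x => ?_, fun {a b} φ => ?_⟩
  · rw [← cancel_mono ((H.resTriangle (w := e x.1 x.2) (f := i x.1) rfl).hom.app b), nat, nat]
    exact congrArg (fun θ => _ ≫ (H.res _).map θ) (hφ x.1)
  · obtain ⟨ψ, hψ⟩ := h'.full fun x =>
      (H.resTriangle (w := e x.1 x.2) (f := i x.1) rfl).hom.app a ≫ (H.res _).map (φ x.1) ≫
        (H.resTriangle (w := e x.1 x.2) (f := i x.1) rfl).inv.app b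
    refine ⟨ψ, fun t => (h t).faithful _ _ fun s => ?_⟩
    have := nat t s ψ
    rw [hψ ⟨t, s⟩] at this
    simpa using this.symm

/-- Equivalences glue: given a morphism of glued families which is an equivalence on each
member, its gluing is an equivalence. -/
lemma IsGlued.isEquivalence_res {T : Type*} {kk ll : T → C} {k l p : C} [IsDiscrete (H.ob p)]
    {i : ∀ t, kk t ⟶ k} {v : ∀ t, p ⟶ kk t} {i' : ∀ t, ll t ⟶ l} {v' : ∀ t, p ⟶ ll t}
    (h : H.IsGlued i v) (h' : H.IsGlued i' v') (g : k ⟶ l) (f : ∀ t, kk t ⟶ ll t)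
    (hi : ∀ t, i t ≫ g = f t ≫ i' t) (hv : ∀ t, v t ≫ f t = v' t)
    (hf : ∀ t, (H.res (f t)).IsEquivalence) : (H.res g).IsEquivalence := by
  have nat (t : T) {a b : H.ob l} (φ : a ⟶ b) := (H.resSquare (hi t)).hom.naturality φ
  have faithful : (H.res g).Faithful := ⟨fun {a b φ ψ} e => h'.fullyFaithful.faithful _ _ fun t =>
    (H.res (f t)).map_injective (by
      have h1 := nat t φ
      have h2 := nat t ψ
      simp only [Functor.comp_map] at h1 h2
      rw [e, h2] at h1
      exact ((cancel_epi _).1 h1).symm)⟩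
  have full : (H.res g).Full := ⟨fun {a b} φ => by
    obtain ⟨ψ, hψ⟩ := h'.fullyFaithful.full fun t => (H.res (f t)).preimage
      ((H.resSquare (hi t)).inv.app a ≫ (H.res (i t)).map φ ≫ (H.resSquare (hi t)).hom.app b)
    refine ⟨ψ, h.fullyFaithful.faithful _ _ fun t => ?_⟩
    have h1 := nat t ψ
    simp only [Functor.comp_map, hψ, Functor.map_preimage] at h1
    rw [Iso.hom_inv_id_app_assoc] at h1
    exact (cancel_mono _).1 h1⟩
  have essSurj : (H.res g).EssSurj := ⟨fun c => by
    obtain ⟨b, hb⟩ := h'.exists_obj (fun t => (H.res (f t)).objPreimage ((H.res (i t)).obj c))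
      (fun t t' => by
        have key (t : T) : (H.res (v' t)).obj ((H.res (f t)).objPreimage ((H.res (i t)).obj c)) =
            (H.res (v t)).obj ((H.res (i t)).obj c) :=
          obj_ext_of_isDiscrete ((H.resTriangle (hv t)).hom.app _ ≫
            (H.res (v t)).map ((H.res (f t)).objObjPreimageIso _).hom)
        rw [key, key]
        exact H.res_obj_eq_of_comm (h.comm t t') c)
    refine ⟨b, h.fullyFaithful.nonempty_iso fun t => ?_⟩
    obtain ⟨θ⟩ := hb t
    exact ⟨(H.resSquare (hi t)).app b ≪≫ (H.res (f t)).mapIso θ ≪≫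
      (H.res (f t)).objObjPreimageIso _⟩⟩
  exact { }

/-- Gluing a piece along an equivalence `H_{kk b} ≌ H_p` does not change the other piece. -/
lemma IsGlued.of_isEquivalence {kk : Bool → C} {k p : C} [IsDiscrete (H.ob p)]
    {i : ∀ t, kk t ⟶ k} {v : ∀ t, p ⟶ kk t} (b : Bool) (hv : (H.res (v b)).IsEquivalence)
    (hi : (H.res (i !b)).IsEquivalence) (hc : v b ≫ i b = v (!b) ≫ i (!b)) : H.IsGlued i v := by
  have ht (t : Bool) : t = b ∨ t = !b := by cases t <;> cases b <;> simp
  refine ⟨fun t t' => ?_, ⟨fun _ _ e => (H.res (i !b)).map_injective (e _), fun φ => ?_⟩,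
    fun a ha => ?_⟩
  · rcases ht t with rfl | rfl <;> rcases ht t' with rfl | rfl <;> simp [hc]
  · refine ⟨(H.res (i !b)).preimage (φ _), fun t => ?_⟩
    rcases ht t with rfl | rfl
    · exact (H.res (v t)).map_injective (Subsingleton.elim _ _)
    · exact (H.res _).map_preimage _
  · refine ⟨(H.res (i !b)).objPreimage (a _), fun t => ?_⟩
    rcases ht t with rfl | rfl
    · exact ⟨(H.res (v t)).preimageIso ((H.resSquare hc).app _ ≪≫
        (H.res (v !t)).mapIso ((H.res (i !t)).objObjPreimageIso _) ≪≫ eqToIso (ha _ _))⟩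
    · exact ⟨(H.res (i !b)).objObjPreimageIso _⟩

/-! ### The comparison of the strictification with the pseudofunctor -/

variable (H)

/-- The fully faithful functor `(St H)_k ⥤ H_k`. -/
@[simps]
def stVal (k : C) : H.StOb k ⥤ H.ob k where
  obj x := x.val
  map φ := StHom.val φ

/-- `stVal` is fully faithful by construction. -/
def fullyFaithfulStVal (k : C) : (H.stVal k).FullyFaithful where
  preimage φ := ⟨φ⟩

instance isEquivalence_stVal (k : C) : (H.stVal k).IsEquivalence where
  faithful := (H.fullyFaithfulStVal k).faithful
  full := (H.fullyFaithfulStVal k).full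
  essSurj := ⟨fun y => ⟨⟨k, 𝟙 k, y⟩, ⟨H.resId y⟩⟩⟩

/-- The functors `(St H)_k ⥤ H_k` are pseudo-natural in `k`. -/
def stResVal {m k : C} (w : m ⟶ k) : H.stRes w ⋙ H.stVal m ≅ H.stVal k ⋙ H.res w :=
  NatIso.ofComponents (fun x => H.resComp w x.arr x.pt) fun _ =>
    (Category.assoc _ _ _).trans (congrArg (_ ≫ ·) ((Category.assoc _ _ _).trans
      ((congrArg (_ ≫ ·) (Iso.inv_hom_id _)).trans (Category.comp_id _))))

lemma isEquivalence_stRes {m k : C} (w : m ⟶ k) (hw : (H.res w).IsEquivalence) :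
    (H.stRes w).IsEquivalence :=
  have : (H.stRes w ⋙ H.stVal m).IsEquivalence :=
    Functor.isEquivalence_of_iso (H.stResVal w).symm
  Functor.isEquivalence_of_comp_right _ (H.stVal m)

lemma eqToHom_toNatTrans_app {D E : Cat.{v, u}} {F G : D ⟶ E} (h : F = G) (x : D) :
    (eqToHom h).toNatTrans.app x = eqToHom (by rw [h]) := by
  subst h
  rfl

lemma stHom_val_mapId (a : LocallyDiscrete Cᵒᵖ) (x : H.StOb a.as.unop) :
    StHom.val (((Functor.toPseudofunctor' (Ps.St.obj H)).mapId a).hom.toNatTrans.app x) =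
      eqToHom (congrArg (fun f => (H.res f).obj x.pt) (Category.id_comp x.arr)) :=
  (congrArg StHom.val (eqToHom_toNatTrans_app ((Ps.St.obj H).map_id a.as) x)).trans
    (StHom.eqToHom_val H _)

lemma stHom_val_mapComp {a b c : LocallyDiscrete Cᵒᵖ} (f : a ⟶ b) (w : b ⟶ c)
    (x : H.StOb a.as.unop) :
    StHom.val (((Functor.toPseudofunctor' (Ps.St.obj H)).mapComp f w).hom.toNatTrans.app x) =
      eqToHom (congrArg (fun f => (H.res f).obj x.pt)
        (Category.assoc w.as.unop f.as.unop x.arr)) :=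
  (congrArg StHom.val
    (eqToHom_toNatTrans_app ((Ps.St.obj H).map_comp f.as w.as) x)).trans (StHom.eqToHom_val H _)

/-- The pseudo-natural transformation `St H ⟶ H` with components `stVal`. -/
def stCounit : (Functor.toPseudofunctor' (Ps.St.obj H) : Ps.{v, u} C) ⟶ H :=
  { app := fun k => (H.stVal k.as.unop).toCatHom
    naturality := fun w => Cat.Hom.isoMk (H.stResVal w.as.unop)
    naturality_naturality := fun {a b f g} η => by
      obtain rfl := obj_ext_of_isDiscrete η
      obtain rfl : η = 𝟙 f := Subsingleton.elim _ _
      rw [PrelaxFunctor.map₂_id, PrelaxFunctor.map₂_id]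
      refine (congrArg (· ≫ _) (Bicategory.id_whiskerRight _ _)).trans ?_
      refine Eq.trans ?_ (congrArg (_ ≫ ·) (Bicategory.whiskerLeft_id _ _)).symm
      exact (Category.id_comp _).trans (Category.comp_id _).symm
    naturality_id := fun a => by
      refine Cat.Hom₂.ext (NatTrans.ext (funext fun x : H.StOb a.as.unop => ?_))
      change (H.resComp (𝟙 _) x.arr x.pt).hom ≫ (H.resId x.val).hom =
        StHom.val (((Functor.toPseudofunctor' (Ps.St.obj H)).mapId a).hom.toNatTrans.app x) ≫
          𝟙 _ ≫ 𝟙 _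
      rw [stHom_val_mapId, resComp_id]
      simp
      exact (Category.comp_id _).symm
    naturality_comp := fun {a b c} f w => by
      refine Cat.Hom₂.ext (NatTrans.ext (funext fun x : H.StOb a.as.unop => ?_))
      change (H.resComp (w.as.unop ≫ f.as.unop) x.arr x.pt).hom ≫
          (H.resComp w.as.unop f.as.unop x.val).hom =
        StHom.val (((Functor.toPseudofunctor' (Ps.St.obj H)).mapComp f w).hom.toNatTrans.app x) ≫
          𝟙 _ ≫ (H.resComp w.as.unop (f.as.unop ≫ x.arr) x.pt).hom ≫ 𝟙 _ ≫
            (H.res w.as.unop).map (H.resComp f.as.unop x.arr x.pt).hom ≫ 𝟙 _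
      rw [stHom_val_mapComp, resComp_assoc]
      simp only [Category.id_comp, Category.comp_id]
      rfl : Pseudofunctor.StrongTrans _ H }

end Ps

namespace FatDelta

/-! ### Morphisms of the fat delta -/

lemma linked_castSucc_succ_iff (k : FatDelta) (j : Fin k.len) :
    k.Linked j.castSucc j.succ ↔ k.link j = true :=
  ⟨fun h => h j (by simp) (by simp), k.linked_edge j⟩

lemma linked_of_le_of_le {k : FatDelta} {x y x' y' : Fin (k.len + 1)} (h : k.Linked x y)
    (hx : x ≤ x') (hxy : x' ≤ y') (hy : y' ≤ y) : k.Linked x' y' := by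
  intro j h1 h2
  refine h j ?_ ?_
  · rw [min_eq_left (hx.trans (hxy.trans hy))]
    rw [min_eq_left hxy] at h1
    exact hx.trans h1
  · rw [max_eq_right (hx.trans (hxy.trans hy))]
    rw [max_eq_right hxy] at h2
    exact h2.trans hy

/-- A map on vertices is a morphism if it is increasing and preserves colours on edges, as coloured
ordinals are free on their edges. -/
def homOfEdges {k l : FatDelta} (g : Fin (k.len + 1) → Fin (l.len + 1))
    (hg : ∀ j : Fin k.len, g j.castSucc < g j.succ)
    (hl : ∀ j : Fin k.len, k.link j = true → l.Linked (g j.castSucc) (g j.succ)) : k ⟶ l where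
  toFun := g
  strictMono := Fin.strictMono_iff_lt_succ.2 hg
  linked := by
    have key (x y : Fin (k.len + 1)) : x ≤ y → k.Linked x y → l.Linked (g x) (g y) := by
      induction y using Fin.induction with
      | zero =>
        intro hx _
        obtain rfl : x = 0 := by simpa using hx
        exact l.linked_refl _
      | succ j ih =>
        intro hx h
        rcases hx.eq_or_lt with rfl | hx
        · exact l.linked_refl _
        · have hx' : x ≤ j.castSucc := Fin.le_castSucc_iff.2 hx
          exact linked_trans (ih hx' (linked_of_le_of_le h le_rfl hx' Fin.castSucc_lt_succ.le))
            (hl j ((k.linked_castSucc_succ_iff j).1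
              (linked_of_le_of_le h hx' Fin.castSucc_lt_succ.le le_rfl)))
    intro x y h
    rcases le_total x y with hxy | hxy
    · exact key x y hxy h
    · exact linked_symm (key y x hxy (linked_symm h))

/-- Composable edges of `l` assemble to a morphism. -/
lemma exists_hom_of_edges {k l : FatDelta} (hk : k.len ≠ 0)
    (f : ∀ j : Fin k.len, edge (k.link j) ⟶ l)
    (hf : ∀ i j : Fin k.len, (i : ℕ) + 1 = j → tgt _ ≫ f i = src _ ≫ f j) :
    ∃ g : k ⟶ l, ∀ j, k.edgeIncl j ≫ g = f j := by
  let g (x : Fin (k.len + 1)) : Fin (l.len + 1) :=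
    if hx : (x : ℕ) < k.len then (f ⟨x, hx⟩).toFun (0 : Fin 2)
    else (f ⟨k.len - 1, by omega⟩).toFun (1 : Fin 2)
  have h0 (j : Fin k.len) : g j.castSucc = (f j).toFun (0 : Fin 2) := dif_pos j.2
  have h1 (j : Fin k.len) : g j.succ = (f j).toFun (1 : Fin 2) := by
    by_cases hj : (j : ℕ) + 1 < k.len
    · exact (dif_pos hj).trans (congrFun (congrArg Hom.toFun (hf j ⟨j + 1, hj⟩ rfl)) 0).symm
    · have e : (⟨k.len - 1, by omega⟩ : Fin k.len) = j := Fin.ext (show k.len - 1 = j by omega)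
      exact (dif_neg hj).trans (congrArg (fun i => (f i).toFun (1 : Fin 2)) e)
  refine ⟨homOfEdges g (fun j => ?_) (fun j hj => ?_), fun j =>
    hom_ext (funext fun x : Fin 2 => ?_)⟩
  · rw [h0, h1]
    exact (f j).strictMono (show (0 : Fin 2) < 1 by decide)
  · rw [h0, h1]
    exact (f j).linked _ _ ((edge (k.link j)).linked_edge (0 : Fin 1) hj)
  · fin_cases x
    exacts [h0 j, h1 j]

lemma hom_ext_of_edges {k l : FatDelta} (hk : k.len ≠ 0) {f g : k ⟶ l}
    (h : ∀ j, k.edgeIncl j ≫ f = k.edgeIncl j ≫ g) : f = g := by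
  have hv (j : Fin k.len) (x : Fin 2) := congrFun (congrArg Hom.toFun (h j)) x
  refine hom_ext (funext fun x => ?_)
  by_cases hx : (x : ℕ) < k.len
  · exact hv ⟨x, hx⟩ 0
  · have e : (⟨k.len - 1, by omega⟩ : Fin k.len).succ = x :=
      Fin.ext (show k.len - 1 + 1 = (x : ℕ) by omega)
    rw [← e]
    exact hv ⟨k.len - 1, by omega⟩ 1

/-- A morphism reflects links if only coloured arrows are sent to coloured arrows. Equivalently,
the induced map on components is injective. -/
def ReflectsLinks {k l : FatDelta} (f : k ⟶ l) : Prop :=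
  ∀ x y, l.Linked (f.toFun x) (f.toFun y) → k.Linked x y

lemma ReflectsLinks.of_edges {k l : FatDelta} {f : k ⟶ l}
    (h : ∀ j : Fin k.len, l.Linked (f.toFun j.castSucc) (f.toFun j.succ) → k.link j = true) :
    ReflectsLinks f := by
  have key (x y : Fin (k.len + 1)) (hxy : x ≤ y) (e : l.Linked (f.toFun x) (f.toFun y)) :
      k.Linked x y := fun j h1 h2 => by
    rw [min_eq_left hxy] at h1
    rw [max_eq_right hxy] at h2
    exact h j (linked_of_le_of_le e (f.strictMono.monotone h1)
      (f.strictMono Fin.castSucc_lt_succ).le (f.strictMono.monotone h2))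
  intro x y e
  rcases le_total x y with hxy | hxy
  · exact key x y hxy e
  · exact linked_symm (key y x hxy (linked_symm e))

/-- A morphism is vertical iff it reflects links, i.e. is injective on components, and hits every
component. -/
lemma isVertical_iff {k l : FatDelta} (f : k ⟶ l) :
    IsVertical f ↔ ReflectsLinks f ∧ ∀ z, ∃ x, l.Linked (f.toFun x) z := by
  refine and_congr ⟨fun h x y e => ?_, fun h x y => ?_⟩ ⟨fun h z => ?_, fun h z => ?_⟩
  · exact Quotient.exact (s := k.linkedSetoid)
      (@h (Quotient.mk _ x) (Quotient.mk _ y) (Quotient.sound (s := l.linkedSetoid) e))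
  · induction x using Quotient.inductionOn
    induction y using Quotient.inductionOn
    exact fun e => Quotient.sound (s := k.linkedSetoid)
      (h _ _ (Quotient.exact (s := l.linkedSetoid) e))
  · obtain ⟨x, hx⟩ := h (Quotient.mk _ z)
    induction x using Quotient.inductionOn with
    | h x => exact ⟨x, Quotient.exact (s := l.linkedSetoid) hx⟩
  · induction z using Quotient.inductionOn with
    | h z =>
      obtain ⟨x, hx⟩ := h z
      exact ⟨Quotient.mk _ x, Quotient.sound (s := l.linkedSetoid) hx⟩

lemma exists_lift_of_reflectsLinks {k l m : FatDelta} {i : m ⟶ l} (hi : ReflectsLinks i)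
    (f : k ⟶ l) (hf : ∀ x, ∃ y, i.toFun y = f.toFun x) : ∃ g : k ⟶ m, g ≫ i = f := by
  choose g hg using hf
  refine ⟨⟨g, fun x y h => ?_, fun x y h => ?_⟩, hom_ext (funext hg)⟩
  · rw [← i.strictMono.lt_iff_lt, hg, hg]
    exact f.strictMono h
  · refine hi _ _ ?_
    rw [hg, hg]
    exact f.linked x y h

lemma isIso_of_reflectsLinks {k l : FatDelta} {f : k ⟶ l} (hf : ReflectsLinks f)
    (h : Function.Surjective f.toFun) : IsIso f := by
  obtain ⟨g, hg⟩ := exists_lift_of_reflectsLinks hf (𝟙 l) h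
  exact ⟨g, hom_ext (funext fun x => f.strictMono.injective
    (congrFun (congrArg Hom.toFun hg) (f.toFun x))), hg⟩

lemma IsVertical.of_comp {k l m : FatDelta} {g : k ⟶ m} {i : m ⟶ l} (hi : ReflectsLinks i)
    (h : IsVertical (g ≫ i)) : IsVertical g := by
  rw [isVertical_iff] at h ⊢
  refine ⟨fun x y e => h.1 x y (i.linked _ _ e), fun z => ?_⟩
  obtain ⟨x, hx⟩ := h.2 (i.toFun z)
  exact ⟨x, hi _ _ hx⟩

/-! ### Concatenation of coloured ordinals -/

/-- The concatenation of two coloured ordinals, identifying the last vertex of the first one with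
the first vertex of the second one. -/
def join (k l : FatDelta) : FatDelta := ⟨k.len + l.len, Fin.append k.link l.link⟩

/-- The edges of the first part of a concatenation. -/
def inlEdge (k l : FatDelta) (j : Fin k.len) : Fin (join k l).len := Fin.castAdd l.len j

/-- The edges of the second part of a concatenation. -/
def inrEdge (k l : FatDelta) (j : Fin l.len) : Fin (join k l).len := Fin.natAdd k.len j

lemma join_edge_cases {k l : FatDelta} {P : Fin (join k l).len → Prop}
    (hl : ∀ j, P (inlEdge k l j)) (hr : ∀ j, P (inrEdge k l j)) (j : Fin (join k l).len) : P j :=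
  Fin.addCases (m := k.len) (n := l.len) hl hr j

lemma join_link_inlEdge (k l : FatDelta) (j : Fin k.len) :
    (join k l).link (inlEdge k l j) = k.link j := Fin.append_left _ _ j

lemma join_link_inrEdge (k l : FatDelta) (j : Fin l.len) :
    (join k l).link (inrEdge k l j) = l.link j := Fin.append_right _ _ j

/-- The inclusion of the first part of a concatenation. -/
def inl (k l : FatDelta) : k ⟶ join k l :=
  homOfEdges (l := join k l) (fun x => ⟨x, show _ < k.len + l.len + 1 by omega⟩)
    (fun j => by simp [Fin.lt_def])
    (fun j h => (join k l).linked_edge (inlEdge k l j) ((join_link_inlEdge k l j).trans h))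

/-- The inclusion of the second part of a concatenation. -/
def inr (k l : FatDelta) : l ⟶ join k l :=
  homOfEdges (l := join k l) (fun x => ⟨k.len + x, show _ < k.len + l.len + 1 by omega⟩)
    (fun j => by simp [Fin.lt_def])
    (fun j h => (join k l).linked_edge (inrEdge k l j) ((join_link_inrEdge k l j).trans h))

lemma castSucc_inlEdge (k l : FatDelta) (j : Fin k.len) :
    (inlEdge k l j).castSucc = (inl k l).toFun j.castSucc := rfl

lemma succ_inlEdge (k l : FatDelta) (j : Fin k.len) :
    (inlEdge k l j).succ = (inl k l).toFun j.succ := rfl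

lemma castSucc_inrEdge (k l : FatDelta) (j : Fin l.len) :
    (inrEdge k l j).castSucc = (inr k l).toFun j.castSucc := rfl

lemma succ_inrEdge (k l : FatDelta) (j : Fin l.len) :
    (inrEdge k l j).succ = (inr k l).toFun j.succ := rfl

lemma reflectsLinks_inl (k l : FatDelta) : ReflectsLinks (inl k l) :=
  .of_edges fun j h => (join_link_inlEdge k l j).symm.trans
    ((linked_castSucc_succ_iff _ (inlEdge k l j)).1 h)

lemma reflectsLinks_inr (k l : FatDelta) : ReflectsLinks (inr k l) :=
  .of_edges fun j h => (join_link_inrEdge k l j).symm.trans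
    ((linked_castSucc_succ_iff _ (inrEdge k l j)).1 h)

lemma exists_inl_eq {k l : FatDelta} {x : Fin ((join k l).len + 1)} (hx : (x : ℕ) ≤ k.len) :
    ∃ y, (inl k l).toFun y = x := ⟨⟨x, Nat.lt_succ_of_le hx⟩, rfl⟩

lemma exists_inr_eq {k l : FatDelta} {x : Fin ((join k l).len + 1)} (hx : k.len ≤ (x : ℕ)) :
    ∃ y, (inr k l).toFun y = x :=
  ⟨⟨x - k.len, by have : (x : ℕ) < k.len + l.len + 1 := x.2; omega⟩,
    Fin.ext (Nat.add_sub_cancel' hx)⟩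

/-- The map on vertices of `desc`. At the common vertex of the two parts the value is that of
`f`. -/
def descFun {k l m : FatDelta} (f : k ⟶ m) (g : l ⟶ m) (x : Fin ((join k l).len + 1)) :
    Fin (m.len + 1) :=
  if hx : (x : ℕ) < k.len + 1 then f.toFun ⟨x, hx⟩
  else g.toFun ⟨x - k.len, by have : (x : ℕ) < k.len + l.len + 1 := x.2; omega⟩

lemma descFun_inl {k l m : FatDelta} (f : k ⟶ m) (g : l ⟶ m) (x : Fin (k.len + 1)) :
    descFun f g ((inl k l).toFun x) = f.toFun x := dif_pos x.2

lemma descFun_inr {k l m : FatDelta} {f : k ⟶ m} {g : l ⟶ m}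
    (h : f.toFun (Fin.last _) = g.toFun 0) (x : Fin (l.len + 1)) :
    descFun f g ((inr k l).toFun x) = g.toFun x := by
  have hx : (((inr k l).toFun x : Fin _) : ℕ) = k.len + x := rfl
  by_cases hx' : (x : ℕ) = 0
  · obtain rfl : x = 0 := Fin.ext hx'
    exact (descFun_inl f g (Fin.last _)).trans h
  · exact (dif_neg (by omega)).trans (congrArg g.toFun (Fin.ext (by simp [hx])))

/-- The morphism out of a concatenation given by morphisms out of its two parts. -/
def desc {k l m : FatDelta} (f : k ⟶ m) (g : l ⟶ m) (h : f.toFun (Fin.last _) = g.toFun 0) :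
    join k l ⟶ m := by
  refine homOfEdges (k := join k l) (descFun f g)
    (join_edge_cases (fun j => ?_) (fun j => ?_))
    (join_edge_cases (fun j hj => ?_) (fun j hj => ?_))
  · rw [castSucc_inlEdge, succ_inlEdge, descFun_inl, descFun_inl]
    exact f.strictMono Fin.castSucc_lt_succ
  · rw [castSucc_inrEdge, succ_inrEdge, descFun_inr h, descFun_inr h]
    exact g.strictMono Fin.castSucc_lt_succ
  · rw [castSucc_inlEdge, succ_inlEdge, descFun_inl, descFun_inl]
    exact f.linked _ _ (k.linked_edge j ((join_link_inlEdge k l j).symm.trans hj))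
  · rw [castSucc_inrEdge, succ_inrEdge, descFun_inr h, descFun_inr h]
    exact g.linked _ _ (l.linked_edge j ((join_link_inrEdge k l j).symm.trans hj))

lemma inl_desc {k l m : FatDelta} (f : k ⟶ m) (g : l ⟶ m)
    (h : f.toFun (Fin.last _) = g.toFun 0) : inl k l ≫ desc f g h = f :=
  hom_ext (funext fun x => descFun_inl f g x)

lemma inr_desc {k l m : FatDelta} (f : k ⟶ m) (g : l ⟶ m)
    (h : f.toFun (Fin.last _) = g.toFun 0) : inr k l ≫ desc f g h = g :=
  hom_ext (funext fun x => descFun_inr h x)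

lemma exists_eq_join {k : FatDelta} (a b : ℕ) (h : k.len = a + b) :
    ∃ l m, l.len = a ∧ m.len = b ∧ k = join l m := by
  obtain ⟨n, link⟩ := k
  obtain rfl : n = a + b := h
  exact ⟨⟨a, fun j => link (Fin.castAdd b j)⟩, ⟨b, fun j => link (Fin.natAdd a j)⟩, rfl, rfl,
    congrArg (FatDelta.mk (a + b)) (Fin.append_castAdd_natAdd (f := link)).symm⟩

lemma eq_point {k : FatDelta} (h : k.len = 0) : k = point := by
  obtain ⟨n, link⟩ := k
  obtain rfl : n = 0 := h
  exact congrArg (FatDelta.mk 0) (Subsingleton.elim _ _)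

lemma exists_eq_edge {k : FatDelta} (h : k.len = 1) : ∃ c, k = edge c := by
  obtain ⟨n, link⟩ := k
  obtain rfl : n = 1 := h
  exact ⟨link 0, congrArg (FatDelta.mk 1) (funext fun j => congrArg link (Subsingleton.elim _ _))⟩

lemma exists_eq_twoEdges {k : FatDelta} (h : k.len = 2) : ∃ c d, k = twoEdges c d := by
  obtain ⟨n, link⟩ := k
  obtain rfl : n = 2 := h
  exact ⟨link 0, link 1, congrArg (FatDelta.mk 2) (funext fun j => by fin_cases j <;> rfl)⟩

end FatDelta

/-! ### Isomorphisms of categories -/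

lemma IsIsoOfCategories.isEquivalence {A B : Type*} [Category* A] [Category* B] {F : A ⥤ B}
    (h : IsIsoOfCategories F) : F.IsEquivalence := by
  obtain ⟨G, h1, h2⟩ := h
  exact (CategoryTheory.Equivalence.mk F G (eqToIso h1.symm) (eqToIso h2)).isEquivalence_functor

lemma IsIsoOfCategories.of_bijective {A B : Type*} [Category* A] [Category* B] (F : A ⥤ B)
    [F.Full] [F.Faithful] (h : Function.Bijective F.obj) : IsIsoOfCategories F := by
  let g := Function.surjInv h.2
  have hg (b : B) : F.obj (g b) = b := Function.surjInv_eq h.2 b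
  let G : B ⥤ A :=
    { obj := g
      map := fun φ => F.preimage (eqToHom (hg _) ≫ φ ≫ eqToHom (hg _).symm)
      map_id := fun b => F.map_injective (by simp)
      map_comp := fun φ ψ => F.map_injective (by simp) }
  refine ⟨G, CategoryTheory.Functor.ext (fun a => h.1 (hg _)) fun a b φ => F.map_injective ?_,
    CategoryTheory.Functor.ext hg fun a b φ => ?_⟩
  · simp [G, eqToHom_map]
  · simp [G]

lemma exists_extension_of_bijective {I J : Type*} {σ : J → I} (hσ : Function.Bijective σ)
    {P : I → Sort*} (a : ∀ j, P (σ j)) : ∃ a' : ∀ i, P i, ∀ j, a' (σ j) = a j := by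
  have (i : I) : ∃ x : P i, ∀ j (h : σ j = i), h ▸ a j = x := by
    obtain ⟨j, rfl⟩ := hσ.2 i
    refine ⟨a j, fun j' h => ?_⟩
    obtain rfl := hσ.1 h
    rfl
  choose a' ha' using this
  exact ⟨a', fun j => (ha' (σ j) j rfl).symm⟩

namespace FatDelta

/-! ### Segal conditions for concatenations -/

variable {H : Ps.{v, u} FatDelta}

lemma edgeIncl_edge (c : Bool) (j : Fin 1) : (edge c).edgeIncl j = 𝟙 (edge c) := by
  obtain rfl : j = 0 := Subsingleton.elim _ _
  refine hom_ext (funext fun x : Fin 2 => ?_)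
  fin_cases x <;> rfl

/-- The Segal condition, up to equivalence: it also holds for ordinals with one edge. -/
lemma IsSegalic.edges (hH : IsSegalic H) {k : FatDelta} (hk : k.len ≠ 0) :
    JointlyFullyFaithful (fun j : Fin k.len => H.res (k.edgeIncl j)) ∧
    ∀ a : (∀ j : Fin k.len, H.ob (edge (k.link j))),
      (∀ i j : Fin k.len, (i : ℕ) + 1 = j →
        (H.res (tgt _)).obj (a i) = (H.res (src _)).obj (a j)) →
      ∃ b : H.ob k, ∀ j, Nonempty ((H.res (k.edgeIncl j)).obj b ≅ a j) := by
  have := hH.discrete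
  by_cases hk1 : k.len = 1
  · obtain ⟨c, rfl⟩ := exists_eq_edge hk1
    have hj (j : Fin (edge c).len) : j = (0 : Fin 1) := Subsingleton.elim (α := Fin 1) _ _
    have h : (H.res ((edge c).edgeIncl (0 : Fin 1))).IsEquivalence := by
      rw [edgeIncl_edge]
      exact H.isEquivalence_res_of_isIso (𝟙 (edge c))
    refine ⟨⟨fun φ ψ e => (H.res ((edge c).edgeIncl (0 : Fin 1))).map_injective (e _), fun φ =>
      ⟨(H.res ((edge c).edgeIncl (0 : Fin 1))).preimage (φ _), fun j => ?_⟩⟩, fun a _ =>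
      ⟨(H.res ((edge c).edgeIncl (0 : Fin 1))).objPreimage (a _), fun j => ?_⟩⟩
    · obtain rfl := hj j
      exact (H.res ((edge c).edgeIncl (0 : Fin 1))).map_preimage _
    · obtain rfl := hj j
      exact ⟨(H.res ((edge c).edgeIncl (0 : Fin 1))).objObjPreimageIso _⟩
  · have hS := hH.segal k (by omega)
    have := hS.isEquivalence
    obtain ⟨G, -, hG⟩ := hS
    refine ⟨⟨fun φ ψ e => (psSegalMap H k).map_injective (IterPullback.Hom.ext (funext e)),
      fun {a b} φ => ?_⟩, fun a ha => ?_⟩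
    · let φ' : (psSegalMap H k).obj a ⟶ (psSegalMap H k).obj b :=
        ⟨φ, fun _ _ _ => Subsingleton.elim _ _⟩
      exact ⟨(psSegalMap H k).preimage φ', fun j => congrFun (congrArg IterPullback.Hom.mor
        ((psSegalMap H k).map_preimage φ')) j⟩
    · exact ⟨G.obj ⟨a, ha⟩, fun j => ⟨eqToIso
        (congrFun (congrArg IterPullback.ob (Functor.congr_obj hG ⟨a, ha⟩)) j)⟩⟩

/-- The Segal condition, up to equivalence, for an arbitrary indexing of the edges. -/
lemma IsSegalic.edge_family (hH : IsSegalic H) {k : FatDelta} (hk : k.len ≠ 0) {J : Type*}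
    {σ : J → Fin k.len} (hσ : Function.Bijective σ) {c : J → Bool} (hc : ∀ j, c j = k.link (σ j))
    (e : ∀ j, edge (c j) ⟶ k) (he : ∀ j, (e j).toFun (0 : Fin 2) = (σ j).castSucc)
    (he' : ∀ j, (e j).toFun (1 : Fin 2) = (σ j).succ) :
    JointlyFullyFaithful (fun j => H.res (e j)) ∧
    ∀ a : (∀ j, H.ob (edge (c j))),
      (∀ i j, (σ i : ℕ) + 1 = σ j → (H.res (tgt _)).obj (a i) = (H.res (src _)).obj (a j)) →
      ∃ b : H.ob k, ∀ j, Nonempty ((H.res (e j)).obj b ≅ a j) := by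
  obtain rfl : c = fun j => k.link (σ j) := funext hc
  obtain rfl : e = fun j => k.edgeIncl (σ j) := by
    refine funext fun j => hom_ext (funext fun x : Fin 2 => ?_)
    fin_cases x
    · exact he j
    · exact he' j
  obtain ⟨h1, h2⟩ := hH.edges hk
  refine ⟨⟨fun φ ψ h => h1.faithful _ _ fun i => ?_, fun φ => ?_⟩, fun a ha => ?_⟩
  · obtain ⟨j, rfl⟩ := hσ.2 i
    exact h j
  · obtain ⟨φ', hφ'⟩ := exists_extension_of_bijective hσ
      (P := fun i => (H.res (k.edgeIncl i)).obj _ ⟶ (H.res (k.edgeIncl i)).obj _) φ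
    obtain ⟨ψ, hψ⟩ := h1.full φ'
    exact ⟨ψ, fun j => (hψ _).trans (hφ' j)⟩
  · obtain ⟨a', ha'⟩ := exists_extension_of_bijective hσ (P := fun i => H.ob (edge (k.link i))) a
    obtain ⟨b, hb⟩ := h2 a' fun i j hij => by
      obtain ⟨i, rfl⟩ := hσ.2 i
      obtain ⟨j, rfl⟩ := hσ.2 j
      rw [ha', ha']
      exact ha i j hij
    exact ⟨b, fun j => ha' j ▸ hb (σ j)⟩

/-- The two parts of a concatenation, as a family. -/
def part (k l : FatDelta) : Bool → FatDelta
  | false => k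
  | true => l

/-- The inclusions `inl` and `inr`, as a family. -/
def partIncl (k l : FatDelta) : ∀ t, part k l t ⟶ join k l
  | false => inl k l
  | true => inr k l

/-- The vertex along which the two parts of a concatenation are glued: the last vertex of the first
part and the first vertex of the second one. -/
def partVertex (k l : FatDelta) : ∀ t, point ⟶ part k l t
  | false => k.vertex (Fin.last _)
  | true => l.vertex 0

/-- The edges of the two parts of a concatenation. -/
def partEdge (k l : FatDelta) : (Σ t, Fin (part k l t).len) → Fin (join k l).len
  | ⟨false, j⟩ => inlEdge k l j
  | ⟨true, j⟩ => inrEdge k l j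

lemma bijective_partEdge (k l : FatDelta) : Function.Bijective (partEdge k l) := by
  have h (j : Fin k.len) : (inlEdge k l j : ℕ) = j := rfl
  have h' (j : Fin l.len) : (inrEdge k l j : ℕ) = k.len + j := rfl
  have hlt {i : Fin k.len} {j : Fin l.len} (e : inlEdge k l i = inrEdge k l j) : False := by
    replace e := congrArg Fin.val e
    rw [h, h'] at e
    omega
  refine ⟨?_, join_edge_cases (fun j => ⟨⟨false, j⟩, rfl⟩) (fun j => ⟨⟨true, j⟩, rfl⟩)⟩
  rintro ⟨_ | _, i⟩ ⟨_ | _, j⟩ e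
  · have e' : (inlEdge k l i : ℕ) = inlEdge k l j := congrArg Fin.val e
    exact congrArg (Sigma.mk false) (Fin.ext e')
  · exact (hlt (i := i) (j := j) e).elim
  · exact (hlt (i := j) (j := i) e.symm).elim
  · have e' : (inrEdge k l i : ℕ) = inrEdge k l j := congrArg Fin.val e
    exact congrArg (Sigma.mk true) (Fin.ext (Nat.add_left_cancel e'))

lemma isEquivalence_res_vertex_point (H : Ps.{v, u} FatDelta) (x : Fin 1) :
    (H.res (point.vertex x)).IsEquivalence := by
  have : point.vertex x = 𝟙 point := hom_ext (funext fun _ => Subsingleton.elim (α := Fin 1) _ _)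
  rw [this]
  exact H.isEquivalence_res_of_isIso (𝟙 point)

/-- For a Segalic pseudofunctor `H`, the value at a concatenation of `k` and `l` is equivalent
to `H_k ×_{H_0} H_l`. -/
lemma IsSegalic.isGlued_join (hH : IsSegalic H) (k l : FatDelta) :
    H.IsGlued (partIncl k l) (partVertex k l) := by
  have := hH.discrete
  -- a part without edges is a single vertex, and the other part is the whole
  by_cases hk : k.len = 0
  · refine .of_isEquivalence false ?_ ?_ rfl
    · obtain rfl := eq_point hk
      exact isEquivalence_res_vertex_point H _
    · have : IsIso (inr k l) := isIso_of_reflectsLinks (reflectsLinks_inr k l)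
        fun x => exists_inr_eq (by omega)
      exact H.isEquivalence_res_of_isIso (inr k l)
  by_cases hl : l.len = 0
  · refine .of_isEquivalence true ?_ ?_ rfl
    · obtain rfl := eq_point hl
      exact isEquivalence_res_vertex_point H _
    · have : IsIso (inl k l) := isIso_of_reflectsLinks (reflectsLinks_inl k l)
        fun x => exists_inl_eq (by have : (x : ℕ) < k.len + l.len + 1 := x.2; omega)
      exact H.isEquivalence_res_of_isIso (inl k l)
  have hp (t : Bool) : (part k l t).len ≠ 0 := by cases t <;> assumption
  have hE := hH.edge_family (k := join k l) (show k.len + l.len ≠ 0 by omega)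
    (bijective_partEdge k l) (c := fun x => (part k l x.1).link x.2)
    (by
      rintro ⟨_ | _, j⟩
      · exact (join_link_inlEdge k l j).symm
      · exact (join_link_inrEdge k l j).symm)
    (fun x => (part k l x.1).edgeIncl x.2 ≫ partIncl k l x.1)
    (by rintro ⟨_ | _, j⟩ <;> rfl) (by rintro ⟨_ | _, j⟩ <;> rfl)
  refine ⟨by rintro (_ | _) (_ | _) <;> rfl,
    Ps.jointlyFullyFaithful_of_comp (fun t => (hH.edges (hp t)).1) hE.1,
    fun a ha => ?_⟩
  obtain ⟨b, hb⟩ := hE.2 (fun x => (H.res ((part k l x.1).edgeIncl x.2)).obj (a x.1)) (by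
    rintro ⟨_ | _, i⟩ ⟨_ | _, j⟩ hij
    · exact H.res_obj_eq_of_comm (tgt_edgeIncl (k := k) (Fin.ext hij)) _
    · replace hij : (i : ℕ) + 1 = k.len + j := hij
      have hi : (i : ℕ) < k.len := i.2
      have e1 : tgt _ ≫ k.edgeIncl i = k.vertex (Fin.last _) :=
        congrArg k.vertex (Fin.ext (show (i : ℕ) + 1 = k.len by omega))
      have e2 : src _ ≫ l.edgeIncl j = l.vertex 0 :=
        congrArg l.vertex (Fin.ext (show (j : ℕ) = 0 by omega))
      exact (H.res_obj_res_obj e1 (a false)).trans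
        ((ha false true).trans (H.res_obj_res_obj e2 (a true)).symm)
    · replace hij : k.len + (i : ℕ) + 1 = j := hij
      have hj : (j : ℕ) < k.len := j.2
      omega
    · replace hij : k.len + (i : ℕ) + 1 = k.len + j := hij
      exact H.res_obj_eq_of_comm (tgt_edgeIncl (k := l)
        (Fin.ext (show (i : ℕ) + 1 = j by omega))) _)
  refine ⟨b, fun t => (hH.edges (hp t)).1.nonempty_iso fun j => ?_⟩
  obtain ⟨θ⟩ := hb ⟨t, j⟩
  exact ⟨((H.resTriangle rfl).app b).symm ≪≫ θ⟩

/-! ### Vertical morphisms act as equivalences -/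

/-- A morphism of concatenations which restricts to equivalences on the two parts is an
equivalence. -/
lemma IsSegalic.isEquivalence_res_of_parts (hH : IsSegalic H) {k k' l l' : FatDelta}
    {g : join k k' ⟶ join l l'} (f : k ⟶ l) (f' : k' ⟶ l') (h : inl k k' ≫ g = f ≫ inl l l')
    (h' : inr k k' ≫ g = f' ≫ inr l l') (hf : f.toFun (Fin.last _) = Fin.last _)
    (hf' : f'.toFun 0 = 0) (e : (H.res f).IsEquivalence) (e' : (H.res f').IsEquivalence) :
    (H.res g).IsEquivalence := by
  have := hH.discrete
  refine (hH.isGlued_join k k').isEquivalence_res (hH.isGlued_join l l') g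
    (fun | false => f | true => f') ?_ ?_ ?_
  · rintro (_ | _)
    exacts [h, h']
  · rintro (_ | _)
    exacts [congrArg l.vertex hf, congrArg l'.vertex hf']
  · rintro (_ | _)
    exacts [e, e']

/-- `H_k ×_{H_0} H_l ⥤ H_k` is an equivalence if `H_l ⥤ H_0` is one. -/
lemma IsSegalic.isEquivalence_res_inl (hH : IsSegalic H) (k l : FatDelta)
    (h : (H.res (l.vertex 0)).IsEquivalence) : (H.res (inl k l)).IsEquivalence := by
  have := hH.discrete
  refine (Ps.IsGlued.of_isEquivalence (H := H) (kk := part k point)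
    (i := fun | false => 𝟙 k | true => k.vertex (Fin.last _)) (v := partVertex k point) true
    (isEquivalence_res_vertex_point H _) (H.isEquivalence_res_of_isIso (𝟙 k))
    rfl).isEquivalence_res (hH.isGlued_join k l) (inl k l)
    (fun | false => 𝟙 k | true => l.vertex 0) ?_ ?_ ?_
  · rintro (_ | _) <;> rfl
  · rintro (_ | _) <;> rfl
  · rintro (_ | _)
    exacts [H.isEquivalence_res_of_isIso (𝟙 k), h]

/-- `H_k ×_{H_0} H_l ⥤ H_l` is an equivalence if `H_k ⥤ H_0` is one. -/
lemma IsSegalic.isEquivalence_res_inr (hH : IsSegalic H) (k l : FatDelta)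
    (h : (H.res (k.vertex (Fin.last _))).IsEquivalence) : (H.res (inr k l)).IsEquivalence := by
  have := hH.discrete
  refine (Ps.IsGlued.of_isEquivalence (H := H) (kk := part point l)
    (i := fun | false => l.vertex 0 | true => 𝟙 l) (v := partVertex point l) false
    (isEquivalence_res_vertex_point H _) (H.isEquivalence_res_of_isIso (𝟙 l))
    rfl).isEquivalence_res (hH.isGlued_join k l) (inr k l)
    (fun | false => k.vertex (Fin.last _) | true => 𝟙 l) ?_ ?_ ?_
  · rintro (_ | _) <;> rfl
  · rintro (_ | _) <;> rfl
  · rintro (_ | _)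
    exacts [h, H.isEquivalence_res_of_isIso (𝟙 l)]

/-- The morphism `join l (edge (c && d)) ⟶ join l (twoEdges c d)` which subdivides the last
edge. -/
def subdivideLast (l : FatDelta) (c d : Bool) :
    join l (edge (c && d)) ⟶ join l (twoEdges c d) :=
  desc (inl _ _) (outer c d ≫ inr _ _) rfl

lemma reflectsLinks_outer (c d : Bool) : ReflectsLinks (outer c d) :=
  .of_edges fun j h => by
    obtain rfl : j = (0 : Fin 1) := Subsingleton.elim (α := Fin 1) _ _
    have hc : c = true := h (0 : Fin 2) (show min (0 : Fin 3) 2 ≤ 0 by decide)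
      (show (1 : Fin 3) ≤ max 0 2 by decide)
    have hd : d = true := h (1 : Fin 2) (show min (0 : Fin 3) 2 ≤ 1 by decide)
      (show (2 : Fin 3) ≤ max 0 2 by decide)
    exact (Bool.and_eq_true_iff).2 ⟨hc, hd⟩

lemma reflectsLinks_subdivideLast (l : FatDelta) (c d : Bool) :
    ReflectsLinks (subdivideLast l c d) := by
  have h1 := inl_desc (inl l (twoEdges c d)) (outer c d ≫ inr l _) rfl
  have h2 := inr_desc (inl l (twoEdges c d)) (outer c d ≫ inr l _) rfl
  refine .of_edges (join_edge_cases (fun j h => ?_) fun j h => ?_)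
  · rw [join_link_inlEdge, ← linked_castSucc_succ_iff]
    refine reflectsLinks_inl l (twoEdges c d) _ _ ?_
    rw [← h1]
    exact h
  · rw [join_link_inrEdge, ← linked_castSucc_succ_iff]
    refine reflectsLinks_outer c d _ _ (reflectsLinks_inr l (twoEdges c d) _ _ ?_)
    have h3 := fun x => congrFun (congrArg Hom.toFun h2) x
    exact (h3 j.castSucc) ▸ (h3 j.succ) ▸ h

lemma IsSegalic.isEquivalence_res_subdivideLast (hH : IsSegalic H) (l : FatDelta) (c d : Bool)
    (h : c = true ∨ d = true) : (H.res (subdivideLast l c d)).IsEquivalence := by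
  refine hH.isEquivalence_res_of_parts (𝟙 l) (outer c d) (inl_desc _ _ _) (inr_desc _ _ _) rfl rfl
    (H.isEquivalence_res_of_isIso (𝟙 l)) ?_
  match c, d, h with
  | true, true, _ => exact hH.comp_unit_unit
  | true, false, _ => exact hH.comp_unit_arrow
  | false, true, _ => exact hH.comp_arrow_unit

/-- A Segalic pseudofunctor sends vertical morphisms to equivalences. The proof is by induction on
the number of edges of the target `l`. If the last vertex of `l` is not in the image of `f`, the
last edge of `l` is a link which can be removed; if it is the image of the last edge of `k`,
both can be removed; if `k` has an edge but its last edge is sent to a composite, the last vertex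
but one of `l` can be removed, thus composing the last two edges, one of which is a link. There
remains the case of a vertex `k` sent to the last vertex of `l`. -/
theorem IsSegalic.isEquivalence_res (hH : IsSegalic H) {k l : FatDelta} (f : k ⟶ l)
    (hf : IsVertical f) : (H.res f).IsEquivalence := by
  induction hn : l.len using Nat.strong_induction_on generalizing k l with
  | _ n ih =>
  subst hn
  by_cases hl : l.len = 0
  · have hs (x : Fin (l.len + 1)) : x = f.toFun 0 := Fin.ext (by omega)
    have : IsIso f := isIso_of_reflectsLinks ((isVertical_iff f).1 hf).1
      fun x => ⟨0, (hs x).symm⟩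
    exact H.isEquivalence_res_of_isIso f
  obtain ⟨hr, hs⟩ := (isVertical_iff f).1 hf
  by_cases h1 : (f.toFun (Fin.last _) : ℕ) = l.len
  · by_cases hk : k.len = 0
    · -- `k` is a vertex, sent to the last vertex of `l`, and all edges of `l` are links
      obtain rfl := eq_point hk
      obtain ⟨l, m, hl', hm, rfl⟩ := exists_eq_join (k := l) (l.len - 1) 1 (by omega)
      obtain ⟨c, rfl⟩ := exists_eq_edge hm
      replace h1 : f.toFun (0 : Fin 1) = Fin.last _ := Fin.ext h1
      have hlast (z) : (join l (edge c)).Linked z (Fin.last _) := by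
        obtain ⟨x, hx⟩ := hs z
        obtain rfl : x = (0 : Fin 1) := Subsingleton.elim (α := Fin 1) _ _
        exact linked_symm (h1 ▸ hx)
      obtain rfl : c = true := (join_link_inrEdge l (edge c) (0 : Fin 1)).symm.trans
        ((linked_castSucc_succ_iff _ _).1 (hlast (inrEdge l (edge c) (0 : Fin 1)).castSucc))
      have hv : IsVertical (l.vertex (Fin.last _)) := by
        refine (isVertical_iff _).2 ⟨fun x y _ => ?_, fun z => ⟨(0 : Fin 1), ?_⟩⟩
        · obtain rfl : x = y := Subsingleton.elim (α := Fin 1) _ _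
          exact linked_refl _ _
        · exact reflectsLinks_inl l (edge true) _ _ (linked_symm
            (linked_of_le_of_le (hlast ((inl l (edge true)).toFun z)) le_rfl
              ((inl l (edge true)).strictMono.monotone (Fin.le_last z)) (Fin.le_last _)))
      have := hH.isEquivalence_res_inr l (edge true) (ih l.len (Nat.lt_succ_self _) _ hv rfl)
      have := hH.tgt_unit
      obtain rfl : f = tgt true ≫ inr l (edge true) := by
        refine hom_ext (funext fun x => ?_)
        obtain rfl : x = (0 : Fin 1) := Subsingleton.elim (α := Fin 1) _ _
        exact h1
      exact H.isEquivalence_res_comp (tgt true) (inr l (edge true))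
    · obtain ⟨k, m, hk', hm, rfl⟩ := exists_eq_join (k := k) (k.len - 1) 1 (by omega)
      obtain ⟨c', rfl⟩ := exists_eq_edge hm
      by_cases h2 : (f.toFun ((inl k _).toFun (Fin.last _)) : ℕ) + 1 = l.len
      · -- the last edge of `l` is the image of the last edge of `k`
        obtain ⟨l, m, hl', hm, rfl⟩ := exists_eq_join (k := l) (l.len - 1) 1 (by omega)
        obtain ⟨c, rfl⟩ := exists_eq_edge hm
        have e0 : f.toFun (inrEdge k (edge c') (0 : Fin 1)).castSucc =
          (inrEdge l (edge c) (0 : Fin 1)).castSucc := Fin.ext (Nat.succ_injective h2)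
        have e1 : f.toFun (inrEdge k (edge c') (0 : Fin 1)).succ =
          (inrEdge l (edge c) (0 : Fin 1)).succ := Fin.ext h1
        obtain rfl : c' = c := by
          refine (join_link_inrEdge k (edge c') (0 : Fin 1)).symm.trans (Eq.trans
            (Bool.eq_iff_iff.2 ?_) (join_link_inrEdge l (edge c) (0 : Fin 1)))
          rw [← linked_castSucc_succ_iff, ← linked_castSucc_succ_iff, ← e0, ← e1]
          exact ⟨f.linked _ _, hr _ _⟩
        obtain ⟨g, hg⟩ := exists_lift_of_reflectsLinks (reflectsLinks_inl l (edge c'))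
          (inl k (edge c') ≫ f) (fun x => exists_inl_eq ((Fin.le_def.1 (f.strictMono.monotone
            ((inl k (edge c')).strictMono.monotone (Fin.le_last x)))).trans
              (Nat.succ_injective h2).le))
        have hg' (x) : (inl l (edge c')).toFun (g.toFun x) =
          f.toFun ((inl k (edge c')).toFun x) := congrFun (congrArg Hom.toFun hg) x
        have hgl : g.toFun (Fin.last _) = Fin.last _ :=
          (inl l (edge c')).strictMono.injective ((hg' _).trans e0)
        have hv : IsVertical g := by
          refine (isVertical_iff g).2 ⟨fun x y h => ?_, fun z => ?_⟩
          · refine reflectsLinks_inl k (edge c') _ _ (hr _ _ ?_)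
            rw [← hg', ← hg']
            exact (inl l (edge c')).linked _ _ h
          · obtain ⟨x, hx⟩ := hs ((inl l (edge c')).toFun z)
            by_cases hxk : (x : ℕ) ≤ k.len
            · obtain ⟨x, rfl⟩ := exists_inl_eq hxk
              exact ⟨x, reflectsLinks_inl l (edge c') _ _ ((hg' x).symm ▸ hx)⟩
            · obtain rfl : x = Fin.last _ := Fin.ext (le_antisymm (Fin.le_last x)
                (not_le.1 hxk))
              refine ⟨Fin.last _, reflectsLinks_inl l (edge c') _ _ (linked_symm ?_)⟩
              refine linked_of_le_of_le (linked_symm hx) le_rfl ?_ ?_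
              · rw [hgl]
                exact (inl l (edge c')).strictMono.monotone (Fin.le_last z)
              · rw [hg']
                exact f.strictMono.monotone (Fin.le_last _)
        refine hH.isEquivalence_res_of_parts g (𝟙 (edge c')) hg.symm ?_ hgl rfl
          (ih l.len (Nat.lt_succ_self _) g hv rfl) (H.isEquivalence_res_of_isIso (𝟙 _))
        refine hom_ext (funext fun x : Fin 2 => ?_)
        fin_cases x
        exacts [e0, e1]
      · -- the last vertex but one of `l` is not in the image of `f`
        have h3 : (f.toFun ((inl k _).toFun (Fin.last _)) : ℕ) < l.len :=
          (Fin.lt_def.1 (f.strictMono (show (inl k (edge c')).toFun (Fin.last _) < Fin.last _ from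
            Nat.lt_succ_self k.len))).trans_le h1.le
        obtain ⟨l, m, hl', hm, rfl⟩ := exists_eq_join (k := l) (l.len - 2) 2 (by omega)
        obtain ⟨c, d, rfl⟩ := exists_eq_twoEdges hm
        have h4 (x) : (f.toFun x : ℕ) ≤ l.len ∨ f.toFun x = Fin.last _ := by
          by_cases hxk : (x : ℕ) ≤ k.len
          · obtain ⟨x, rfl⟩ := exists_inl_eq hxk
            have := Fin.le_def.1 (f.strictMono.monotone
              ((inl k (edge c')).strictMono.monotone (Fin.le_last x)))
            replace h3 : _ < l.len + 2 := h3
            replace h2 : ¬ _ = l.len + 2 := h2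
            exact Or.inl (by omega)
          · obtain rfl : x = Fin.last _ := Fin.ext (le_antisymm (Fin.le_last x) (not_le.1 hxk))
            exact Or.inr (Fin.ext h1)
        -- the missed vertex is linked to one in the image, so one of its two edges is a link
        have hcd : c = true ∨ d = true := by
          obtain ⟨x, hx⟩ := hs ((inr l (twoEdges c d)).toFun (1 : Fin 3))
          rcases h4 x with h | h
          · left
            refine (join_link_inrEdge l (twoEdges c d) (0 : Fin 2)).symm.trans
              (hx _ ((min_le_left _ _).trans h) (le_max_right _ _))
          · right
            refine (join_link_inrEdge l (twoEdges c d) (1 : Fin 2)).symm.trans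
              (hx _ (min_le_right _ _) ?_)
            rw [h]
            exact (Fin.le_last _).trans (le_max_left _ _)
        obtain ⟨g, rfl⟩ := exists_lift_of_reflectsLinks (reflectsLinks_subdivideLast l c d) f
          fun x => by
            rcases h4 x with h | h
            · obtain ⟨y, hy⟩ := exists_inl_eq h
              exact ⟨(inl _ _).toFun y,
                (descFun_inl (inl l (twoEdges c d)) (outer c d ≫ inr l _) y).trans hy⟩
            · exact ⟨(inr _ _).toFun (1 : Fin 2),
                (descFun_inr (f := inl l (twoEdges c d)) (g := outer c d ≫ inr l _) rfl
                  (1 : Fin 2)).trans h.symm⟩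
        have := hH.isEquivalence_res_subdivideLast l c d hcd
        have := ih (l.len + 1) (Nat.lt_succ_self _) g
          (.of_comp (reflectsLinks_subdivideLast l c d) hf) rfl
        exact H.isEquivalence_res_comp g (subdivideLast l c d)
  · -- the last vertex of `l` is not in the image of `f`
    obtain ⟨l, m, hl', hm, rfl⟩ := exists_eq_join (k := l) (l.len - 1) 1 (by omega)
    obtain ⟨c, rfl⟩ := exists_eq_edge hm
    have h2 (x) : (f.toFun x : ℕ) ≤ l.len := by
      have := Fin.le_def.1 (f.strictMono.monotone (Fin.le_last x))
      have h3 : (f.toFun (Fin.last _) : ℕ) < l.len + 1 + 1 := (f.toFun (Fin.last _)).2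
      replace h1 : ¬ _ = l.len + 1 := h1
      omega
    obtain ⟨x, hx⟩ := hs (Fin.last _)
    obtain rfl : c = true := (join_link_inrEdge l (edge c) (0 : Fin 1)).symm.trans
      (hx (inrEdge l (edge c) (0 : Fin 1)) ((min_le_left _ _).trans (h2 x)) (le_max_right _ _))
    obtain ⟨g, rfl⟩ := exists_lift_of_reflectsLinks (reflectsLinks_inl l (edge true)) f
      fun x => exists_inl_eq (h2 x)
    have := hH.isEquivalence_res_inl l (edge true) hH.src_unit
    have := ih l.len (Nat.lt_succ_self _) g (.of_comp (reflectsLinks_inl l (edge true)) hf) rfl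
    exact H.isEquivalence_res_comp g (inl l (edge true))

end FatDelta

namespace FatDelta

variable {H : Ps.{v, u} FatDelta}

/-! ### The Segal conditions for the strictification -/

/-- As `H_0` is discrete, so that `(St H)_0` is an equivalence relation, all parallel morphisms
of `(St H)_0` are equal. -/
instance subsingleton_hom_stOb_point [IsDiscrete (H.ob point)] (x y : H.StOb point) :
    Subsingleton (x ⟶ y) :=
  ⟨fun _ _ => Ps.StHom.ext (Subsingleton.elim _ _)⟩

lemma isHomotopicallyDiscrete_stOb_point [IsDiscrete (H.ob point)] :
    IsHomotopicallyDiscrete (H.StOb point) where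
  isGroupoid := ⟨fun f => ⟨⟨eqToHom (obj_ext_of_isDiscrete f.val).symm⟩, Subsingleton.elim _ _,
    Subsingleton.elim _ _⟩⟩
  loop _ _ := Subsingleton.elim _ _

/-- The value of the strictification at `k` embeds jointly fully faithfully into its values at the
edges of `k`, because `H_k` does. -/
lemma IsSegalic.jointlyFullyFaithful_stRes (hH : IsSegalic H) {k : FatDelta} (hk : k.len ≠ 0) :
    JointlyFullyFaithful fun j : Fin k.len => H.stRes (k.edgeIncl j) := by
  have h := (hH.edges hk).1
  have nat (j : Fin k.len) {x y : H.StOb k} (φ : x ⟶ y) :=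
    (H.stResVal (k.edgeIncl j)).hom.naturality φ
  refine ⟨fun {x y} φ ψ e => Ps.StHom.ext (h.faithful _ _ fun j => ?_), fun {x y} φ => ?_⟩
  · have h1 := nat j φ
    have h2 := nat j ψ
    simp only [Functor.comp_map] at h1 h2
    rw [e, h2] at h1
    exact ((cancel_epi _).1 h1).symm
  · obtain ⟨ψ, hψ⟩ := h.full fun j => (H.stResVal (k.edgeIncl j)).inv.app x ≫ (φ j).val ≫
      (H.stResVal (k.edgeIncl j)).hom.app y
    refine ⟨⟨ψ⟩, fun j => Ps.StHom.ext ?_⟩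
    have h1 := nat j (x := x) (y := y) ⟨ψ⟩
    simp only [Functor.comp_map, Ps.stVal_map, hψ] at h1
    rw [Iso.hom_inv_id_app_assoc] at h1
    exact (((H.stResVal (k.edgeIncl j)).app y).cancel_iso_hom_right _ _).1 h1

/-- Bijectivity on objects holds for the strictification of any pseudofunctor: objects are
morphisms out of `k` decorated by a point, and composable edges glue uniquely. -/
lemma isIso_segalMap (hH : IsSegalic H) {k : FatDelta} (hk : k.len ≠ 0) :
    IsIsoOfCategories (segalMap (Ps.St.obj H) k) := by
  have := hH.discrete
  have h := hH.jointlyFullyFaithful_stRes hk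
  have : (segalMap (Ps.St.obj H) k).Full := ⟨fun {x y} φ => by
    obtain ⟨ψ, hψ⟩ := h.full φ.mor
    exact ⟨ψ, IterPullback.Hom.ext (funext hψ)⟩⟩
  have : (segalMap (Ps.St.obj H) k).Faithful := ⟨fun {x y φ ψ} e =>
    h.faithful _ _ fun j => congrFun (congrArg IterPullback.Hom.mor e) j⟩
  have hpos : 0 < k.len := Nat.pos_of_ne_zero hk
  refine .of_bijective _ ⟨?_, ?_⟩
  · rintro ⟨r, f, y⟩ ⟨r', f', y'⟩ e
    have e (j : Fin k.len) : (⟨r, k.edgeIncl j ≫ f, y⟩ : H.StOb _) =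
      ⟨r', k.edgeIncl j ≫ f', y'⟩ := congrFun (congrArg IterPullback.ob e) j
    obtain ⟨rfl, -, h⟩ := Ps.StOb.mk.inj (e ⟨0, hpos⟩)
    obtain rfl := eq_of_heq h
    have e' (j : Fin k.len) : k.edgeIncl j ≫ f = k.edgeIncl j ≫ f' :=
      eq_of_heq (Ps.StOb.mk.inj (e j)).2.1
    obtain rfl : f = f' := hom_ext_of_edges hk e'
    rfl
  · intro a
    have hc (i j : Fin k.len) (hij : (i : ℕ) + 1 = j) :
      (⟨(a.ob i).idx, tgt _ ≫ (a.ob i).arr, (a.ob i).pt⟩ : H.StOb point) =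
        ⟨(a.ob j).idx, src _ ≫ (a.ob j).arr, (a.ob j).pt⟩ := a.compat i j hij
    -- all components of `a` lie in the same summand and over the same point
    have key (n : ℕ) (hn : n < k.len) : ∃ f, a.ob ⟨n, hn⟩ =
        (⟨(a.ob ⟨0, hpos⟩).idx, f, (a.ob ⟨0, hpos⟩).pt⟩ : H.StOb _) := by
      induction n with
      | zero => exact ⟨_, rfl⟩
      | succ n ih =>
        obtain ⟨f, hf⟩ := ih (by omega)
        have := hc ⟨n, by omega⟩ ⟨n + 1, hn⟩ rfl
        rw [hf] at this
        generalize a.ob ⟨n + 1, hn⟩ = z at this ⊢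
        obtain ⟨r, g, y⟩ := z
        obtain ⟨h1, -, h2⟩ := Ps.StOb.mk.inj this
        dsimp only at h1 h2
        subst h1
        obtain rfl := eq_of_heq h2
        exact ⟨g, rfl⟩
    obtain ⟨r, y, hry⟩ : ∃ r y, ∀ j, ∃ f, a.ob j = (⟨r, f, y⟩ : H.StOb _) :=
      ⟨_, _, fun j => key j j.2⟩
    choose f hf using hry
    have hf' (i j : Fin k.len) (hij : (i : ℕ) + 1 = j) : tgt _ ≫ f i = src _ ≫ f j := by
      have := hc i j hij
      rw [hf, hf] at this
      exact eq_of_heq (Ps.StOb.mk.inj this).2.1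
    obtain ⟨g, hg⟩ := exists_hom_of_edges hk f hf'
    refine ⟨⟨r, g, y⟩, ?_⟩
    obtain ⟨ob, compat⟩ := a
    obtain rfl : (fun j => (H.stRes (k.edgeIncl j)).obj ⟨r, g, y⟩) = ob :=
      funext fun j => (congrArg (fun f => (⟨r, f, y⟩ : H.StOb _)) (hg j)).trans (hf j).symm
    rfl

/-- Components composable over the discretization of `(St H)_0` have values which are strictly
composable over `H_0`, so that the Segal condition for `H` gives an object of `H_k`. -/
lemma isEquivalence_inducedSegalMap (hH : IsSegalic H) {k : FatDelta} (hk : k.len ≠ 0)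
    [IsGroupoid ((Ps.St.obj H).obj (op point))] :
    (inducedSegalMap (Ps.St.obj H) k).IsEquivalence := by
  have := hH.discrete
  have full : (inducedSegalMap (Ps.St.obj H) k).Full := ⟨fun {x y} φ =>
    ⟨⟨φ.mor, fun _ _ _ => (subsingleton_hom_stOb_point (H := H) _ _).elim _ _⟩, rfl⟩⟩
  have faithful : (inducedSegalMap (Ps.St.obj H) k).Faithful := ⟨fun {x y φ ψ} e =>
    IterPullback.Hom.ext (funext fun j => congrFun (congrArg IterPullback.Hom.mor e) j)⟩
  have essSurj : (inducedSegalMap (Ps.St.obj H) k).EssSurj := ⟨fun a => by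
    let a' (j : Fin k.len) : H.StOb (edge (k.link j)) := a.ob j
    -- the values of the components of `a` are composable in `H`, as `H_0` is discrete
    obtain ⟨b, hb⟩ := (hH.edges hk).2 (fun j => (a' j).val) fun i j hij => by
      obtain ⟨θ⟩ := Quotient.exact (congrArg Discrete.as (a.compat i j hij))
      exact (H.res_obj_res_obj rfl _).trans
        ((obj_ext_of_isDiscrete (C := H.ob point) θ.hom.val).trans (H.res_obj_res_obj rfl _).symm)
    let c : H.StOb k := ⟨k, 𝟙 k, b⟩
    have e (j : Fin k.len) : Nonempty ((H.stRes (k.edgeIncl j)).obj c ≅ a' j) :=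
      ⟨(H.stVal _).preimageIso ((hb j).some)⟩
    refine ⟨(segalMap (Ps.St.obj H) k).obj c, ⟨⟨⟨fun j => (e j).some.hom, ?_⟩,
      ⟨fun j => (e j).some.inv, ?_⟩, ?_, ?_⟩⟩⟩
    · exact fun _ _ _ => Subsingleton.elim _ _
    · exact fun _ _ _ => Subsingleton.elim _ _
    · exact IterPullback.Hom.ext (funext fun j => (e j).some.hom_inv_id)
    · exact IterPullback.Hom.ext (funext fun j => (e j).some.inv_hom_id)⟩
  exact { }

lemma IsSegalic.isWeaklyGlobularFair_st (hH : IsSegalic H) :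
    IsWeaklyGlobularFair (Ps.St.obj H) where
  homotopicallyDiscrete :=
    have := hH.discrete
    isHomotopicallyDiscrete_stOb_point (H := H)
  segal k hk := isIso_segalMap hH (by omega)
  inducedSegal k hk :=
    have := hH.discrete
    haveI : IsGroupoid ((Ps.St.obj H).obj (op point)) :=
      (isHomotopicallyDiscrete_stOb_point (H := H)).isGroupoid
    isEquivalence_inducedSegalMap hH (by omega)
  colours f hf := H.isEquivalence_stRes f (hH.isEquivalence_res f hf)

end FatDelta

theorem mainTheorem4 :
    (∃ S : SegPs.{v, u}.FullSubcategory ⥤ FairWG.{v, u}.FullSubcategory,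
      S ⋙ FairWG.{v, u}.ι = SegPs.{v, u}.ι ⋙ Ps.St) ∧
    ∀ H : Ps.{v, u} FatDelta, SegPs H →
      ∃ g : (Functor.toPseudofunctor' (Ps.St.obj H) : Ps.{v, u} FatDelta) ⟶ H,
        ∀ k : FatDelta, (g.app ⟨op k⟩).toFunctor.IsEquivalence :=
  ⟨⟨FairWG.lift (SegPs.ι ⋙ Ps.St) fun H => FatDelta.IsSegalic.isWeaklyGlobularFair_st H.property,
    rfl⟩, fun H _ => ⟨H.stCounit, fun k => H.isEquivalence_stVal k⟩⟩
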